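/- Let $d\ge 1$, let $(X_k)_{k\ge 1}$ be independent and identically distributed random variables with values in $\mathbb R^d$ and common distribution $\mu$, and let $\mu_n=\frac1n\sum_{k=1}^n\delta_{X_k}$ be the empirical measure. Let $p\ge 1$ and $r\in(1,2)$ be real numbers, and let $$W_p^p(\nu_1,\nu_2)=\inf_{\pi}\int_{\mathbb R^d\times\mathbb R^d}|x-y|_2^p\,\pi(dx,dy),$$ where $|\cdot|_2$ is the Euclidean norm and the infimum is over all probability measures $\pi$ on $\mathbb R^d\times\mathbb R^d$ with margins $\nu_1$ and $\nu_2$. Assume that $\int_{\mathbb R^d}|x|^{rp}\,\mu(dx)<\infty$, where $|x|=\max_{1\le i\le d}|x_i|$. 1. If $p>d(r-1)/r$, then $\displaystyle\lim_{n\to\infty} n^{(r-1)/r}\,W_p^p(\mu_n,\mu)=0$ almost surely. 2. If $p<d(r-1)/r$, then $\displaystyle\lim_{n\to\infty}\frac{n^{p/d}}{(\log n)^{1/r}}\,W_p^p(\mu_n,\mu)=0$ almost surely. -/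

import Mathlib

open MeasureTheory ProbabilityTheory Filter
open scoped ENNReal Topology

namespace EmpiricalWasserstein

/-- The empirical measure `(1 / n) ∑ δ_{x k}` of the first `n` points of the sequence `x`
(a probability measure as soon as `n ≥ 1`). -/
noncomputable def empiricalMeasure {E : Type*} [MeasurableSpace E] (x : ℕ → E) (n : ℕ) :
    Measure E :=
  (n : ℝ≥0∞)⁻¹ • ∑ k ∈ Finset.range n, Measure.dirac (x k)

/-- The set of probability measures on `E × E` with margins `ν₁` and `ν₂`. -/
def couplings {E : Type*} [MeasurableSpace E] (ν₁ ν₂ : Measure E) : Set (Measure (E × E)) :=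
  {π | IsProbabilityMeasure π ∧ π.map Prod.fst = ν₁ ∧ π.map Prod.snd = ν₂}

/-- The `p`-th power `W_p^p` of the Wasserstein distance of order `p` on `ℝ^d`, with values in
`[0, ∞]`; the cost is the `p`-th power of the Euclidean distance. -/
noncomputable def wassersteinPow {d : ℕ} (p : ℝ) (ν₁ ν₂ : Measure (EuclideanSpace ℝ (Fin d))) :
    ℝ≥0∞ :=
  ⨅ π ∈ couplings ν₁ ν₂, ∫⁻ z, edist z.1 z.2 ^ p ∂π

/-- The strong moment of order `q` of `μ`, that is `‖X‖_q ^ q = 𝔼 (|X| ^ q)` for `X` of law `μ`,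
where `|x| = max_i |x_i|` (`WithLp.ofLp x` is `x` seen in `Fin d → ℝ`, which carries the
sup norm). -/
noncomputable def strongMoment {d : ℕ} (q : ℝ) (μ : Measure (EuclideanSpace ℝ (Fin d))) : ℝ≥0∞ :=
  ∫⁻ x, ‖WithLp.ofLp x‖ₑ ^ q ∂μ

end EmpiricalWasserstein

/-! The cost is bounded by a multiscale transport. Space is cut into dyadic shells of radius 2^m,
and shell m into about 2^(dj) cubes of side 2^(m-j), for j = 0, 1, 2, ... From fine to coarse, as
much mass as possible is matched inside each cell and the rest is handed to the parent cell. What a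
cell hands over is the discrepancy of its two masses, so that n W_p^p ≤ C Σ_{m,j} 2^(p(m-j))
D_{m,j}(n), with D the total discrepancy `cellGap` (`exists_coupling_le`,
`mul_wassersteinPow_empiricalMeasure_le`).

For n ≤ 2^N there are two bounds on D. It is at most the number of points in the shell plus its
expectation (`totalMeasure`); and by Doob's inequality and Cauchy–Schwarz over the cells, a bound
uniform in n ≤ 2^N has second moment O(2^(dj) 2^N μ(shell m)) (`lintegral_sq_cellGapMax_le`). The
moment assumption is Σ_m 2^(rpm) μ(shell m) < ∞, so a typical cell has mass about 2^(-rpm-dj). The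
bounds are exchanged where such a cell expects one point, at dj + rpm = N: `finePart` beyond it,
`coarsePart` below it.

If p > d(r-1)/r, then after multiplication by 2^(-N/r) the mean of the fine part and the second
moment of the coarse part are summable in N. Summing over N first gives geometric series dominated
by their value at the threshold, which leaves 2^(rpm) μ(shell m) 2^(κj) with κ < 0.

If p < d(r-1)/r, the cells at the threshold dominate and both parts have order 2^((1-p/d)N): the
fine one almost surely, by the strong law applied to 2^(rp·shell), the coarse one in L². The extra
factor N^(-1/r) sends the first to 0 and makes the squares of the second summable, because 2/r > 1.
-/

namespace EmpiricalWasserstein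

/-! ### Couplings built along refining countable partitions. -/

section Coupling

variable {E I I' : Type*} [MeasurableSpace E] [MeasurableSpace I] [Countable I]
  [MeasurableSingletonClass I] [MeasurableSpace I'] [Countable I'] [MeasurableSingletonClass I']

theorem inv_max_mul_mul {a b : ℝ≥0∞} (ha : a ≠ ∞) (hb : b ≠ ∞) :
    (max a b)⁻¹ * b * a = min a b := by
  rcases eq_or_ne (max a b) 0 with h | h
  · have h1 : a = 0 := by simpa using (le_max_left a b).trans h.le
    have h2 : b = 0 := by simpa using (le_max_right a b).trans h.le
    simp [h1, h2]
  · have hT : max a b ≠ ∞ := by simp [ha, hb]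
    rw [mul_assoc, mul_comm b a, ← min_mul_max a b, mul_comm (min a b), ← mul_assoc,
      ENNReal.inv_mul_cancel h hT, one_mul]

theorem inv_max_mul_le_one (a b : ℝ≥0∞) : (max a b)⁻¹ * b ≤ 1 := by
  rw [mul_comm, ← div_eq_mul_inv]
  exact ENNReal.div_le_of_le_mul (by simp)

/-- Two finite measures can be matched inside the fibers of `T`, as much as possible. -/
theorem exists_matching (α β : Measure E) [IsFiniteMeasure α] [IsFiniteMeasure β] {T : E → I}
    (hT : Measurable T) :
    ∃ π : Measure (E × E), π.map Prod.fst ≤ α ∧ π.map Prod.snd ≤ β ∧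
      (∀ i, π.map Prod.fst (T ⁻¹' {i}) = min (α (T ⁻¹' {i})) (β (T ⁻¹' {i}))) ∧
      (∀ i, π.map Prod.snd (T ⁻¹' {i}) = min (α (T ⁻¹' {i})) (β (T ⁻¹' {i}))) ∧
      ∀ᵐ z ∂π, T z.1 = T z.2 := by
  have hF : ∀ i, MeasurableSet (T ⁻¹' {i}) := fun i => hT (measurableSet_singleton i)
  have hsum : ∀ (γ : Measure E), Measure.sum (fun i => γ.restrict (T ⁻¹' {i})) = γ := by
    intro γ
    rw [← Measure.restrict_iUnion _ hF]
    · rw [← Set.preimage_iUnion, Set.iUnion_of_singleton]; simp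
    · intro i j hij
      exact Disjoint.preimage T (by simpa using hij)
  have hval : ∀ (γ : Measure E) (t : I → ℝ≥0∞) (i : I),
      Measure.sum (fun k => t k • γ.restrict (T ⁻¹' {k})) (T ⁻¹' {i}) = t i * γ (T ⁻¹' {i}) := by
    intro γ t i
    rw [Measure.sum_apply _ (hF i), tsum_eq_single i]
    · simp
    · intro k hk
      have : T ⁻¹' {i} ∩ T ⁻¹' {k} = ∅ := by
        ext x; simp only [Set.mem_inter_iff, Set.mem_preimage, Set.mem_singleton_iff,
          Set.mem_empty_iff_false, iff_false]
        rintro ⟨h1, h2⟩; exact hk (h2.symm.trans h1)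
      simp [Measure.restrict_apply (hF i), this]
  set a : I → ℝ≥0∞ := fun i => α (T ⁻¹' {i}) with ha
  set b : I → ℝ≥0∞ := fun i => β (T ⁻¹' {i}) with hb
  -- In each fiber, a normalized product measure: dividing by the larger of the two masses keeps
  -- both margins below α and β and gives total mass min (a i) (b i). An empty fiber causes no
  -- trouble, since ∞ * 0 = 0.
  set π : Measure (E × E) := Measure.sum fun i =>
    (max (a i) (b i))⁻¹ • (α.restrict (T ⁻¹' {i})).prod (β.restrict (T ⁻¹' {i})) with hπ
  have h1 : π.map Prod.fst =
      Measure.sum fun i => ((max (a i) (b i))⁻¹ * b i) • α.restrict (T ⁻¹' {i}) := by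
    rw [hπ, Measure.map_sum measurable_fst.aemeasurable]
    congr 1; ext1 i
    rw [Measure.map_smul, Measure.map_fst_prod, smul_smul]
    simp [hb]
  have h2 : π.map Prod.snd =
      Measure.sum fun i => ((max (b i) (a i))⁻¹ * a i) • β.restrict (T ⁻¹' {i}) := by
    rw [hπ, Measure.map_sum measurable_snd.aemeasurable]
    congr 1; ext1 i
    rw [Measure.map_smul, Measure.map_snd_prod, smul_smul, max_comm]
    simp [ha]
  have hle : ∀ (γ : Measure E) (t : I → ℝ≥0∞), (∀ i, t i ≤ 1) →
      Measure.sum (fun k => t k • γ.restrict (T ⁻¹' {k})) ≤ γ := by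
    intro γ t ht
    conv_rhs => rw [← hsum γ]
    refine Measure.le_iff.2 fun s hs => ?_
    rw [Measure.sum_apply _ hs, Measure.sum_apply _ hs]
    refine ENNReal.tsum_le_tsum fun i => ?_
    simpa using mul_le_mul_left (ht i) (γ.restrict (T ⁻¹' {i}) s)
  refine ⟨π, ?_, ?_, fun i => ?_, fun i => ?_, ?_⟩
  · rw [h1]; exact hle _ _ fun i => inv_max_mul_le_one _ _
  · rw [h2]; exact hle _ _ fun i => inv_max_mul_le_one _ _
  · rw [h1, hval]; exact inv_max_mul_mul (measure_ne_top _ _) (measure_ne_top _ _)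
  · rw [h2, hval, min_comm]; exact inv_max_mul_mul (measure_ne_top _ _) (measure_ne_top _ _)
  · rw [hπ, Measure.ae_sum_iff]
    intro i
    refine Measure.ae_smul_measure ?_ _
    rw [Measure.prod_restrict]
    filter_upwards [ae_restrict_mem ((hF i).prod (hF i))] with z hz
    have h1 : T z.1 = i := hz.1
    have h2 : T z.2 = i := hz.2
    rw [h1, h2]

theorem lintegral_comp_countable (γ : Measure E) {T : E → I} (hT : Measurable T) (w : I → ℝ≥0∞) :
    ∫⁻ x, w (T x) ∂γ = ∑' i, w i * γ (T ⁻¹' {i}) := by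
  have hw : Measurable w := measurable_of_countable w
  rw [← lintegral_map hw hT, lintegral_countable']
  exact tsum_congr fun i => by rw [Measure.map_apply hT (measurableSet_singleton i)]

theorem measure_preimage_comp {K : Type*} [MeasurableSpace K] [MeasurableSingletonClass K]
    (γ : Measure E) {T : E → I} (hT : Measurable T) (g : I → K) (i' : K) :
    γ ((g ∘ T) ⁻¹' {i'}) = ∑' i, (g ⁻¹' {i'}).indicator 1 i * γ (T ⁻¹' {i}) := by
  classical
  rw [← lintegral_comp_countable γ hT]
  have hg : Measurable g := measurable_of_countable g
  have : MeasurableSet ((g ∘ T) ⁻¹' {i'}) := (hg.comp hT) (measurableSet_singleton i')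
  rw [← lintegral_indicator_one this]
  rfl

/-- A partial coupling of `μ` and `ν` which is saturated in the fibers of `T`. -/
structure IsSaturated (μ ν : Measure E) (T : E → I) (ρ : Measure (E × E)) : Prop where
  fst_le : ρ.map Prod.fst ≤ μ
  snd_le : ρ.map Prod.snd ≤ ν
  fst_eq : ∀ i, ρ.map Prod.fst (T ⁻¹' {i}) = min (μ (T ⁻¹' {i})) (ν (T ⁻¹' {i}))
  snd_eq : ∀ i, ρ.map Prod.snd (T ⁻¹' {i}) = min (μ (T ⁻¹' {i})) (ν (T ⁻¹' {i}))

/-- The gap `|a - b|` in `[0, ∞]`. -/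
noncomputable def gap (a b : ℝ≥0∞) : ℝ≥0∞ := (a - b) + (b - a)

theorem add_min_sub_sub {s a b : ℝ≥0∞} (ha : s ≤ a) (hb : s ≤ b) :
    s + min (a - s) (b - s) = min a b := by
  rw [← min_add_add_left, add_tsub_cancel_of_le ha, add_tsub_cancel_of_le hb]

/-- One step of the multiscale construction: the mass that ρ leaves unmatched is matched inside the
coarser fibers. In a fine fiber the unmatched masses are a - min a b and b - min a b, whose sum is
the gap, hence the cost added. -/
theorem IsSaturated.coarsen {μ ν : Measure E} [IsFiniteMeasure μ] [IsFiniteMeasure ν] {T : E → I}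
    (hT : Measurable T) {ρ : Measure (E × E)} (hρ : IsSaturated μ ν T ρ) (g : I → I')
    (w : I → ℝ≥0∞) (c : E × E → ℝ≥0∞)
    (hw : ∀ x y, g (T x) = g (T y) → c (x, y) ≤ w (T x) + w (T y)) :
    ∃ ρ', IsSaturated μ ν (g ∘ T) ρ' ∧
      ∫⁻ z, c z ∂ρ' ≤ ∫⁻ z, c z ∂ρ + ∑' i, w i * gap (μ (T ⁻¹' {i})) (ν (T ⁻¹' {i})) := by
  have hg : Measurable g := measurable_of_countable g
  have hgT : Measurable (g ∘ T) := hg.comp hT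
  have hwm : Measurable w := measurable_of_countable w
  have hF : ∀ i, MeasurableSet (T ⁻¹' {i}) := fun i => hT (measurableSet_singleton i)
  have hF' : ∀ i, MeasurableSet ((g ∘ T) ⁻¹' {i}) := fun i => hgT (measurableSet_singleton i)
  have f1 : IsFiniteMeasure (ρ.map Prod.fst) := isFiniteMeasure_of_le μ hρ.fst_le
  have f2 : IsFiniteMeasure (ρ.map Prod.snd) := isFiniteMeasure_of_le ν hρ.snd_le
  -- The margins of ρ agree on fine fibers, hence on their unions. With s this common mass, s + min
  -- (a - s) (b - s) = min a b gives saturation at the coarse level.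
  have hsame : ∀ i', ρ.map Prod.fst ((g ∘ T) ⁻¹' {i'}) = ρ.map Prod.snd ((g ∘ T) ⁻¹' {i'}) := by
    intro i'
    rw [measure_preimage_comp _ hT, measure_preimage_comp _ hT]
    simp_rw [hρ.fst_eq, hρ.snd_eq]
  obtain ⟨π, p1, p2, p3, p4, p5⟩ := exists_matching (μ - ρ.map Prod.fst) (ν - ρ.map Prod.snd) hgT
  have a1 : π.map Prod.fst + ρ.map Prod.fst ≤ μ := by
    calc _ ≤ (μ - ρ.map Prod.fst) + ρ.map Prod.fst := add_le_add_left p1 _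
      _ = μ := Measure.sub_add_cancel_of_le hρ.fst_le
  have a2 : π.map Prod.snd + ρ.map Prod.snd ≤ ν := by
    calc _ ≤ (ν - ρ.map Prod.snd) + ρ.map Prod.snd := add_le_add_left p2 _
      _ = ν := Measure.sub_add_cancel_of_le hρ.snd_le
  have s1 : ∀ s, MeasurableSet s → (μ - ρ.map Prod.fst) s = μ s - ρ.map Prod.fst s := fun s hs =>
    Measure.sub_apply hs hρ.fst_le
  have s2 : ∀ s, MeasurableSet s → (ν - ρ.map Prod.snd) s = ν s - ρ.map Prod.snd s := fun s hs =>
    Measure.sub_apply hs hρ.snd_le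
  have e1 : (ρ + π).map Prod.fst = π.map Prod.fst + ρ.map Prod.fst := by
    rw [Measure.map_add _ _ measurable_fst, add_comm]
  have e2 : (ρ + π).map Prod.snd = π.map Prod.snd + ρ.map Prod.snd := by
    rw [Measure.map_add _ _ measurable_snd, add_comm]
  refine ⟨ρ + π, ⟨by rwa [e1], by rwa [e2], fun i => ?_, fun i => ?_⟩, ?_⟩
  · rw [e1, Measure.add_apply, p3, s1 _ (hF' i), s2 _ (hF' i), ← hsame, add_comm]
    exact add_min_sub_sub (hρ.fst_le _) (by rw [hsame]; exact hρ.snd_le _)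
  · rw [e2, Measure.add_apply, p4, s1 _ (hF' i), s2 _ (hF' i), ← hsame, add_comm]
    exact add_min_sub_sub (hρ.fst_le _) (by rw [hsame]; exact hρ.snd_le _)
  · rw [lintegral_add_measure]
    gcongr
    calc ∫⁻ z, c z ∂π ≤ ∫⁻ z, w (T z.1) + w (T z.2) ∂π := by
          refine lintegral_mono_ae ?_
          filter_upwards [p5] with z hz
          exact hw _ _ hz
      _ = ∫⁻ x, w (T x) ∂(π.map Prod.fst) + ∫⁻ x, w (T x) ∂(π.map Prod.snd) := by
          rw [lintegral_add_left (by fun_prop), lintegral_map (by fun_prop) (by fun_prop),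
            lintegral_map (by fun_prop) (by fun_prop)]
      _ ≤ ∫⁻ x, w (T x) ∂(μ - ρ.map Prod.fst) + ∫⁻ x, w (T x) ∂(ν - ρ.map Prod.snd) :=
          add_le_add (lintegral_mono' p1 le_rfl) (lintegral_mono' p2 le_rfl)
      _ = ∑' i, w i * gap (μ (T ⁻¹' {i})) (ν (T ⁻¹' {i})) := by
          rw [lintegral_comp_countable _ hT, lintegral_comp_countable _ hT, ← ENNReal.tsum_add]
          refine tsum_congr fun i => ?_
          rw [← mul_add, s1 _ (hF i), s2 _ (hF i), hρ.fst_eq, hρ.snd_eq, gap, tsub_min,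
            min_comm, tsub_min]

theorem IsSaturated.isCoupling {μ ν : Measure E} [IsProbabilityMeasure μ] [IsProbabilityMeasure ν]
    {ρ : Measure (E × E)} (hρ : IsSaturated μ ν (fun _ => ()) ρ) : ρ ∈ couplings μ ν := by
  have h1 : ρ.map Prod.fst Set.univ = 1 := by simpa using hρ.fst_eq ()
  have h2 : ρ.map Prod.snd Set.univ = 1 := by simpa using hρ.snd_eq ()
  refine ⟨⟨?_⟩, ?_, ?_⟩
  · rw [Measure.map_apply measurable_fst .univ] at h1; simpa using h1
  · have : IsFiniteMeasure (ρ.map Prod.fst) := isFiniteMeasure_of_le μ hρ.fst_le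
    exact Measure.eq_of_le_of_measure_univ_eq hρ.fst_le (by simp [h1])
  · have : IsFiniteMeasure (ρ.map Prod.snd) := isFiniteMeasure_of_le ν hρ.snd_le
    exact Measure.eq_of_le_of_measure_univ_eq hρ.snd_le (by simp [h2])

/-- Transport cost along a refining sequence of countable partitions. -/
theorem exists_coupling_le {μ ν : Measure E} [IsProbabilityMeasure μ] [IsProbabilityMeasure ν]
    {T : ℕ → E → I} (hT : ∀ j, Measurable (T j)) (g : ℕ → I → I) (hg : ∀ j, g j ∘ T (j + 1) = T j)
    (w : ℕ → I → ℝ≥0∞) (c : E × E → ℝ≥0∞)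
    (h0 : ∀ x y, c (x, y) ≤ w 0 (T 0 x) + w 0 (T 0 y))
    (hw : ∀ j x y, T j x = T j y → c (x, y) ≤ w (j + 1) (T (j + 1) x)) (J : ℕ) :
    ∃ π ∈ couplings μ ν, ∫⁻ z, c z ∂π ≤ ∫⁻ x, w (J + 1) (T (J + 1) x) ∂μ +
      ∑ j ∈ Finset.range (J + 1),
        ∑' i, w j i * gap (μ (T j ⁻¹' {i})) (ν (T j ⁻¹' {i})) := by
  set s : ℕ → ℝ≥0∞ := fun j => ∑' i, w j i * gap (μ (T j ⁻¹' {i})) (ν (T j ⁻¹' {i}))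
  -- Descending induction on the generation J - k. Mass left over at generation j + 1 travels inside
  -- a cell of generation j, so `w (j + 1)` measures the diameter of the parent cell; this explains
  -- the index shift in `hw`.
  have key : ∀ k ≤ J, ∃ ρ, IsSaturated μ ν (T (J - k)) ρ ∧ ∫⁻ z, c z ∂ρ ≤
      ∫⁻ x, w (J + 1) (T (J + 1) x) ∂μ + ∑ j ∈ Finset.Ico (J - k + 1) (J + 1), s j := by
    intro k
    induction k with
    | zero =>
      intro _
      obtain ⟨π, p1, p2, p3, p4, p5⟩ := exists_matching μ ν (hT J)
      refine ⟨π, ⟨p1, p2, p3, p4⟩, ?_⟩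
      have hwm : Measurable (w (J + 1)) := measurable_of_countable _
      have hTm := hT (J + 1)
      calc ∫⁻ z, c z ∂π ≤ ∫⁻ z, w (J + 1) (T (J + 1) z.1) ∂π := by
            refine lintegral_mono_ae ?_
            filter_upwards [p5] with z hz
            exact hw _ _ _ hz
        _ = ∫⁻ x, w (J + 1) (T (J + 1) x) ∂(π.map Prod.fst) := by
            rw [lintegral_map (by fun_prop) (by fun_prop)]
        _ ≤ ∫⁻ x, w (J + 1) (T (J + 1) x) ∂μ := lintegral_mono' p1 le_rfl
        _ ≤ _ := by simp
    | succ k ih =>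
      intro hk
      obtain ⟨ρ, hρ, hc⟩ := ih (by omega)
      obtain ⟨i, hi⟩ : ∃ i, J - k = i + 1 := ⟨J - k - 1, by omega⟩
      have hi' : J - (k + 1) = i := by omega
      rw [hi] at hρ hc
      rw [hi']
      obtain ⟨ρ', hρ', hc'⟩ := hρ.coarsen (hT _) (g i) (w (i + 1)) c (fun x y hxy =>
        (hw i x y (by rw [← hg]; exact hxy)).trans le_self_add)
      rw [hg] at hρ'
      refine ⟨ρ', hρ', hc'.trans ?_⟩
      rw [Finset.sum_eq_sum_Ico_succ_bot (by omega : i + 1 < J + 1), add_comm (s (i + 1)),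
        ← add_assoc]
      gcongr
  obtain ⟨ρ, hρ, hc⟩ := key J le_rfl
  rw [Nat.sub_self] at hρ hc
  -- The last step merges everything into one cell; saturation there means that all the mass is
  -- coupled.
  obtain ⟨π, hπ, hc'⟩ := hρ.coarsen (hT 0) (fun _ => ()) (w 0) c (fun x y _ => h0 x y)
  refine ⟨π, hπ.isCoupling, hc'.trans ?_⟩
  rw [Finset.range_eq_Ico, Finset.sum_eq_sum_Ico_succ_bot (by omega : 0 < J + 1), add_comm (s 0),
    ← add_assoc]
  gcongr

end Coupling

/-! ### Doob's L² maximal inequality, from a pathwise inequality. -/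

section Maximal

/-- Summation by parts for the running maximum: when the maximum M jumps to the new value s, the
slack is (s - M)² / 2; otherwise the inequality is preserved exactly. -/
theorem half_sq_partialSups_add_sum_le (s : ℕ → ℝ) (n : ℕ) :
    (partialSups s n) ^ 2 / 2 + ∑ k ∈ Finset.range n, partialSups s k * (s (k + 1) - s k) ≤
      partialSups s n * s n + s 0 ^ 2 / 2 := by
  induction n with
  | zero => simp; nlinarith [sq_nonneg (s 0)]
  | succ n ih =>
    rw [Finset.sum_range_succ, partialSups_add_one]
    rcases le_total (s (n + 1)) (partialSups s n) with h | h
    · rw [sup_of_le_left h]; nlinarith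
    · rw [sup_of_le_right h]; nlinarith [sq_nonneg (s (n + 1) - partialSups s n)]

/-- Pathwise form of Doob's inequality. It combines |S + Y| - |S| ≥ sign(S) Y with M|S| ≤ M²/4 + S².
The sum on the left is a discrete stochastic integral, of mean zero for independent centered Y. -/
theorem sq_partialSups_abs_le (S Y : ℕ → ℝ) (h0 : S 0 = 0) (hS : ∀ k, S (k + 1) = S k + Y k)
    (n : ℕ) :
    (partialSups (fun k => |S k|) n) ^ 2 / 4 +
      ∑ k ∈ Finset.range n, partialSups (fun k => |S k|) k * SignType.sign (S k) * Y k ≤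
      S n ^ 2 := by
  have h := half_sq_partialSups_add_sum_le (fun k => |S k|) n
  have h2 : ∑ k ∈ Finset.range n, partialSups (fun k => |S k|) k * SignType.sign (S k) * Y k ≤
      ∑ k ∈ Finset.range n, partialSups (fun k => |S k|) k * (|S (k + 1)| - |S k|) := by
    refine Finset.sum_le_sum fun k _ => ?_
    rw [mul_assoc]
    refine mul_le_mul_of_nonneg_left ?_
      ((abs_nonneg _).trans (le_partialSups (fun k => |S k|) k))
    rw [hS]
    rcases lt_trichotomy (S k) 0 with h | h | h
    · rw [sign_neg h, abs_of_neg h]; simp; linarith [neg_abs_le (S k + Y k)]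
    · rw [h]; simp
    · rw [sign_pos h, abs_of_pos h]; simp; linarith [le_abs_self (S k + Y k)]
  simp only [h0, abs_zero] at h
  nlinarith [sq_nonneg (partialSups (fun k => |S k|) n / 2 - |S n|), sq_abs (S n)]

theorem measurable_partialSups_abs_sum {Ω : Type*} {m : MeasurableSpace Ω} {Y : ℕ → Ω → ℝ} (n : ℕ)
    (hY : ∀ k < n, Measurable[m] (Y k)) :
    Measurable[m] fun ω => partialSups (fun i => |∑ k ∈ Finset.range i, Y k ω|) n := by
  induction n with
  | zero => simp
  | succ n ih =>
    simp only [partialSups_add_one]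
    refine (ih fun k hk => hY k (by omega)).sup ?_
    have : Measurable[m] fun ω => ∑ k ∈ Finset.range (n + 1), Y k ω :=
      Finset.measurable_sum _ fun k hk => hY k (Finset.mem_range.1 hk)
    exact measurable_abs.comp this

theorem abs_sum_range_le {y : ℕ → ℝ} {K : ℝ} (hK : ∀ k, |y k| ≤ K) (n : ℕ) :
    |∑ k ∈ Finset.range n, y k| ≤ n * K :=
  (Finset.abs_sum_le_sum_abs _ _).trans
    ((Finset.sum_le_card_nsmul _ _ K fun k _ => hK k).trans (by simp))

theorem partialSups_abs_sum_le {y : ℕ → ℝ} {K : ℝ} (hK : ∀ k, |y k| ≤ K) (n : ℕ) :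
    partialSups (fun i => |∑ k ∈ Finset.range i, y k|) n ≤ n * K := by
  refine partialSups_le _ _ _ fun i hi => (abs_sum_range_le hK i).trans ?_
  have : 0 ≤ K := (abs_nonneg _).trans (hK 0)
  gcongr

variable {Ω : Type*} [MeasurableSpace Ω] {P : Measure Ω} [IsProbabilityMeasure P]

/-- Doob's `L²` maximal inequality for sums of bounded independent centered variables. -/
theorem integral_sq_partialSups_le {Y : ℕ → Ω → ℝ} (hm : ∀ k, Measurable (Y k))
    (hind : iIndepFun Y P) {K v : ℝ} (hK : ∀ k ω, |Y k ω| ≤ K) (h0 : ∀ k, ∫ ω, Y k ω ∂P = 0)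
    (hv : ∀ k, ∫ ω, Y k ω ^ 2 ∂P ≤ v) (n : ℕ) :
    ∫ ω, (partialSups (fun i => |∑ k ∈ Finset.range i, Y k ω|) n) ^ 2 ∂P ≤ 4 * (n * v) := by
  set S : ℕ → Ω → ℝ := fun n ω => ∑ k ∈ Finset.range n, Y k ω with hS
  set M : ℕ → Ω → ℝ := fun n ω => partialSups (fun i => |S i ω|) n with hM
  have hSm : ∀ n, Measurable (S n) := fun n => Finset.measurable_sum _ fun k _ => hm k
  have hMm : ∀ n, Measurable (M n) := fun n => measurable_partialSups_abs_sum n fun k _ => hm k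
  have hK0 : 0 ≤ K := by
    obtain ⟨ω⟩ : Nonempty Ω := P.nonempty_of_neZero
    exact (abs_nonneg _).trans (hK 0 ω)
  have hM0 : ∀ n ω, 0 ≤ M n ω := fun n ω =>
    (abs_nonneg _).trans (le_partialSups (fun i => |S i ω|) n)
  have hMK : ∀ n ω, M n ω ≤ n * K := fun n ω => partialSups_abs_sum_le (fun k => hK k ω) n
  have hSK : ∀ n ω, |S n ω| ≤ n * K := fun n ω => abs_sum_range_le (fun k => hK k ω) n
  have hbdd : ∀ {f : Ω → ℝ} (_ : Measurable f) (B : ℝ) (_ : ∀ ω, |f ω| ≤ B), Integrable f P :=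
    fun hf B hB => Integrable.of_bound hf.aestronglyMeasurable B
      (Eventually.of_forall fun ω => by simpa using hB ω)
  -- The hypothesis on f says that it depends only on the Y i with i < k; it is used with m the
  -- σ-algebra they generate.
  have hindk : ∀ k (f : Ω → ℝ), (∀ m : MeasurableSpace Ω, (∀ i < k, Measurable[m] (Y i)) →
      Measurable[m] f) → ∫ ω, f ω * Y k ω ∂P = 0 := by
    intro k f hf
    have hI : IndepFun f (Y k) P := by
      have := indep_iSup_of_disjoint (m := fun i => MeasurableSpace.comap (Y i) inferInstance)
        (fun i => (hm i).comap_le) hind (S := {i | i < k}) (T := {k}) (by simp)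
      refine indep_of_indep_of_le_left (indep_of_indep_of_le_right this ?_) ?_
      · simp
      · refine (hf _ fun i hi => ?_).comap_le
        refine Measurable.mono (comap_measurable (Y i)) ?_ le_rfl
        exact le_iSup₂_of_le i hi le_rfl
    have hfm : Measurable f := hf _ fun i _ => hm i
    have := hI.integral_mul_eq_mul_integral hfm.aestronglyMeasurable (hm k).aestronglyMeasurable
    simp only [Pi.mul_apply] at this
    rw [this, h0, mul_zero]
  have hSsq : ∀ n : ℕ, ∫ ω, S n ω ^ 2 ∂P ≤ n * v := by
    intro n
    induction n with
    | zero => simp [hS]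
    | succ n ih =>
      have e : ∀ ω, S (n + 1) ω ^ 2 = S n ω ^ 2 + 2 * (S n ω * Y n ω) + Y n ω ^ 2 := by
        intro ω; simp only [hS, Finset.sum_range_succ]; ring
      have i1 : Integrable (fun ω => S n ω ^ 2) P :=
        hbdd ((hSm n).pow_const 2) ((n * K) ^ 2) fun ω => by
          rw [abs_pow]; exact pow_le_pow_left₀ (abs_nonneg _) (hSK n ω) 2
      have i2 : Integrable (fun ω => 2 * (S n ω * Y n ω)) P :=
        (hbdd ((hSm n).mul (hm n)) ((n * K) * K) fun ω => by
          rw [Pi.mul_apply, abs_mul]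
          exact mul_le_mul (hSK n ω) (hK n ω) (abs_nonneg _) (by positivity)).const_mul 2
      have i3 : Integrable (fun ω => Y n ω ^ 2) P :=
        hbdd ((hm n).pow_const 2) (K ^ 2) fun ω => by
          rw [abs_pow]; exact pow_le_pow_left₀ (abs_nonneg _) (hK n ω) 2
      simp_rw [e]
      rw [integral_add (f := fun ω => S n ω ^ 2 + 2 * (S n ω * Y n ω)) (i1.add i2) i3,
        integral_add i1 i2, integral_const_mul,
        hindk n (S n) (fun m h => Finset.measurable_sum _ fun k hk => h k (Finset.mem_range.1 hk))]
      push_cast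
      linarith [hv n]
  have hsign : Measurable fun x : ℝ => ((SignType.sign x : SignType) : ℝ) := by
    have : (fun x : ℝ => ((SignType.sign x : SignType) : ℝ)) =
        fun x => if 0 < x then 1 else if x < 0 then -1 else 0 := by
      ext x
      rcases lt_trichotomy x 0 with h | h | h
      · simp [h, h.not_gt]
      · simp [h]
      · simp [h]
    rw [this]
    exact Measurable.ite measurableSet_Ioi measurable_const
      (Measurable.ite measurableSet_Iio measurable_const measurable_const)
  have hZ : ∀ k, ∫ ω, M k ω * SignType.sign (S k ω) * Y k ω ∂P = 0 := fun k =>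
    hindk k (fun ω => M k ω * SignType.sign (S k ω)) fun m h =>
      (measurable_partialSups_abs_sum k h).mul (hsign.comp
        (Finset.measurable_sum _ fun i hi => h i (Finset.mem_range.1 hi)))
  have hZi : ∀ k, Integrable (fun ω => M k ω * SignType.sign (S k ω) * Y k ω) P := by
    intro k
    refine hbdd (((hMm k).mul (hsign.comp (hSm k))).mul (hm k)) (k * K * 1 * K) fun ω => ?_
    rw [abs_mul, abs_mul, abs_of_nonneg (hM0 k ω)]
    have : |((SignType.sign (S k ω) : SignType) : ℝ)| ≤ 1 := by
      rcases SignType.sign (S k ω) with _ | _ | _ <;> simp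
    exact mul_le_mul (mul_le_mul (hMK k ω) this (abs_nonneg _) (by positivity)) (hK k ω)
      (abs_nonneg _) (by positivity)
  have hMi : Integrable (fun ω => M n ω ^ 2 / 4) P := by
    refine (hbdd ((hMm n).pow_const 2) ((n * K) ^ 2) fun ω => ?_).div_const 4
    rw [abs_pow, abs_of_nonneg (hM0 n ω)]; exact pow_le_pow_left₀ (hM0 n ω) (hMK n ω) 2
  have hSi : Integrable (fun ω => S n ω ^ 2) P :=
    hbdd ((hSm n).pow_const 2) ((n * K) ^ 2) fun ω => by
      rw [abs_pow]; exact pow_le_pow_left₀ (abs_nonneg _) (hSK n ω) 2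
  have hfin : ∫ ω, M n ω ^ 2 / 4 ∂P ≤ ∫ ω, S n ω ^ 2 ∂P := by
    have h1 : ∫ ω, (M n ω ^ 2 / 4 +
        ∑ k ∈ Finset.range n, M k ω * SignType.sign (S k ω) * Y k ω) ∂P ≤ ∫ ω, S n ω ^ 2 ∂P := by
      refine integral_mono (hMi.add (integrable_finsetSum _ fun k _ => hZi k)) hSi fun ω => ?_
      exact sq_partialSups_abs_le (fun k => S k ω) (fun k => Y k ω) (by simp [hS])
        (fun k => by simp [hS, Finset.sum_range_succ]) n
    rw [integral_add hMi (integrable_finsetSum _ fun k _ => hZi k),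
      integral_finsetSum _ fun k _ => hZi k, Finset.sum_eq_zero fun k _ => hZ k, add_zero] at h1
    exact h1
  rw [integral_div] at hfin
  have := hSsq n
  change ∫ ω, M n ω ^ 2 ∂P ≤ _
  linarith

end Maximal

/-! ### Real powers of 2 in [0, ∞]. -/

section PowTwo

/-- The powers `2 ^ x` in `[0, ∞]`, for a real exponent `x`. -/
noncomputable def pow2 (x : ℝ) : ℝ≥0∞ := (2 : ℝ≥0∞) ^ x

theorem pow2_add (x y : ℝ) : pow2 (x + y) = pow2 x * pow2 y :=
  ENNReal.rpow_add _ _ two_ne_zero ENNReal.ofNat_ne_top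

theorem pow2_mono {x y : ℝ} (h : x ≤ y) : pow2 x ≤ pow2 y :=
  ENNReal.rpow_le_rpow_of_exponent_le one_le_two h

theorem pow2_zero : pow2 0 = 1 := ENNReal.rpow_zero

theorem pow2_ne_top (x : ℝ) : pow2 x ≠ ∞ := by simp [pow2]

theorem pow2_natCast (n : ℕ) : pow2 n = 2 ^ n := ENNReal.rpow_natCast _ _

theorem pow2_mul (x y : ℝ) : pow2 (x * y) = pow2 x ^ y := ENNReal.rpow_mul _ _ _

theorem pow2_mul_natCast (x : ℝ) (n : ℕ) : pow2 (x * n) = pow2 x ^ n := by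
  rw [pow2_mul, ENNReal.rpow_natCast]

theorem pow2_one : pow2 1 = 2 := by simp [pow2]

theorem pow2_eq_ofReal (x : ℝ) : pow2 x = ENNReal.ofReal (2 ^ x) := by
  rw [pow2, ← ENNReal.ofReal_rpow_of_pos two_pos]; simp

theorem pow2_lt_one {x : ℝ} (h : x < 0) : pow2 x < 1 :=
  ENNReal.rpow_lt_one_of_one_lt_of_neg (by norm_num) h

end PowTwo

/-! ### Cauchy–Schwarz inequalities in [0, ∞]. -/

section CauchySchwarz

theorem two_mul_mul_le_sq_add_sq (a b : ℝ≥0∞) : 2 * (a * b) ≤ a ^ 2 + b ^ 2 := by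
  wlog h : a ≤ b generalizing a b
  · rw [mul_comm a, add_comm]; exact this b a (le_of_not_ge h)
  obtain ⟨c, rfl⟩ := exists_add_of_le h
  calc 2 * (a * (a + c)) ≤ 2 * (a * (a + c)) + c ^ 2 := le_self_add
    _ = a ^ 2 + (a + c) ^ 2 := by ring

/-- Expanding the square into a double sum and using 2 h_i h_j ≤ h_i² + h_j² avoids any finiteness
condition. -/
theorem sq_tsum_mul_le {ι : Type*} (g h : ι → ℝ≥0∞) :
    (∑' i, g i * h i) ^ 2 ≤ (∑' i, g i) * ∑' i, g i * h i ^ 2 := by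
  have e : 2 * (∑' i, g i * h i) ^ 2 ≤ 2 * ((∑' i, g i) * ∑' i, g i * h i ^ 2) := by
    calc 2 * (∑' i, g i * h i) ^ 2 = ∑' i, ∑' j, g i * g j * (2 * (h i * h j)) := by
          rw [sq, ← ENNReal.tsum_mul_right, ← ENNReal.tsum_mul_left]
          refine tsum_congr fun i => ?_
          rw [← ENNReal.tsum_mul_left, ← ENNReal.tsum_mul_left]
          exact tsum_congr fun j => by ring
      _ ≤ ∑' i, ∑' j, g i * g j * (h i ^ 2 + h j ^ 2) :=
          ENNReal.tsum_le_tsum fun i => ENNReal.tsum_le_tsum fun j => by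
            gcongr; exact two_mul_mul_le_sq_add_sq _ _
      _ = ∑' i, ∑' j, (g j * (g i * h i ^ 2) + g i * (g j * h j ^ 2)) :=
          tsum_congr fun i => tsum_congr fun j => by ring
      _ = 2 * ((∑' i, g i) * ∑' i, g i * h i ^ 2) := by
          simp_rw [ENNReal.tsum_add, ENNReal.tsum_mul_right, ENNReal.tsum_mul_left,
            ENNReal.tsum_mul_right]
          ring
  exact (ENNReal.mul_le_mul_iff_right two_ne_zero ENNReal.ofNat_ne_top).1 e

theorem sq_sum_le_card_mul {ι : Type*} (s : Finset ι) (h : ι → ℝ≥0∞) :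
    (∑ i ∈ s, h i) ^ 2 ≤ s.card * ∑ i ∈ s, h i ^ 2 := by
  have := sq_tsum_mul_le (fun _ : s => 1) (fun i : s => h i)
  simp only [one_mul, Finset.tsum_subtype s h, Finset.tsum_subtype s (fun i => h i ^ 2)] at this
  simpa using this

end CauchySchwarz

/-! ### Dyadic shells and their subdivision into cubes. -/

section Cells

variable {d : ℕ}

/-- The index of the dyadic shell around the origin which contains `x`. -/
noncomputable def shell (x : EuclideanSpace ℝ (Fin d)) : ℕ := Nat.size ⌊‖WithLp.ofLp x‖⌋₊

theorem norm_lt_two_pow_shell (x : EuclideanSpace ℝ (Fin d)) :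
    ‖WithLp.ofLp x‖ < 2 ^ shell x := by
  have h := Nat.lt_size_self ⌊‖WithLp.ofLp x‖⌋₊
  have := (Nat.floor_lt (norm_nonneg _)).1 h
  exact_mod_cast this

theorem two_pow_shell_le (x : EuclideanSpace ℝ (Fin d)) :
    (2 : ℝ) ^ shell x ≤ max 1 (2 * ‖WithLp.ofLp x‖) := by
  rcases Nat.eq_zero_or_pos (shell x) with h | h
  · simp [h]
  · obtain ⟨k, hk⟩ := Nat.exists_eq_succ_of_ne_zero h.ne'
    have h1 : k < Nat.size ⌊‖WithLp.ofLp x‖⌋₊ := by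
      have : Nat.size ⌊‖WithLp.ofLp x‖⌋₊ = k + 1 := hk
      omega
    rw [Nat.lt_size] at h1
    have h2 := (Nat.le_floor_iff (norm_nonneg _)).1 h1
    push_cast at h2
    refine le_max_of_le_right ?_
    rw [hk, pow_succ]; linarith

theorem measurable_shell : Measurable (shell (d := d)) := by
  have h : Measurable fun x : EuclideanSpace ℝ (Fin d) => WithLp.ofLp x :=
    (PiLp.continuous_ofLp 2 _).measurable
  exact (measurable_from_top (f := Nat.size)).comp (Nat.measurable_floor.comp h.norm)

/-- The index of the cell of generation `j` which contains `x`: each shell, of radius `2 ^ m`, is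
cut into cubes of side `2 ^ (m - j)`. -/
noncomputable def cell (j : ℕ) (x : EuclideanSpace ℝ (Fin d)) : ℕ × (Fin d → ℤ) :=
  (shell x, fun i => ⌊2 ^ j * x i / 2 ^ shell x⌋)

theorem measurable_cell (j : ℕ) : Measurable (cell (d := d) j) := by
  refine measurable_shell.prodMk (measurable_pi_lambda _ fun i => Int.measurable_floor.comp ?_)
  have h : Measurable fun x : EuclideanSpace ℝ (Fin d) => x i := by fun_prop
  have h' : Measurable fun x : EuclideanSpace ℝ (Fin d) => (2 : ℝ) ^ shell x :=
    (measurable_from_top (f := fun n : ℕ => (2 : ℝ) ^ n)).comp measurable_shell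
  exact (h.const_mul _).div h'

theorem halve_comp_cell (j : ℕ) :
    (fun i : ℕ × (Fin d → ℤ) => (i.1, fun l => i.2 l / 2)) ∘ cell (j + 1) = cell j := by
  ext x
  · rfl
  · rename_i l
    simp only [cell, Function.comp]
    have := Int.floor_div_natCast (2 ^ (j + 1) * x l / 2 ^ shell x) 2
    push_cast at this
    rw [← this]
    congr 1
    rw [pow_succ]
    ring

/-- The indices of the cells of generation `j` in each shell. -/
noncomputable def cellBox (d j : ℕ) : Finset (Fin d → ℤ) :=
  Fintype.piFinset fun _ => Finset.Ico (-2 ^ j) (2 ^ j)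

theorem card_cellBox (d j : ℕ) : ((cellBox d j).card : ℝ≥0∞) = pow2 (d * (j + 1)) := by
  have : (2 ^ j - -2 ^ j : ℤ) = ((2 ^ (j + 1) : ℕ) : ℤ) := by push_cast; ring
  rw [cellBox, Fintype.card_piFinset]
  simp only [Int.card_Ico, this, Int.toNat_natCast, Finset.prod_const, Finset.card_univ,
    Fintype.card_fin]
  have h : (d * (j + 1) : ℝ) = ((d * (j + 1) : ℕ) : ℝ) := by push_cast; ring
  rw [h, pow2_natCast]
  push_cast
  rw [← pow_mul, mul_comm]

theorem cell_snd_mem (j : ℕ) (x : EuclideanSpace ℝ (Fin d)) : (cell j x).2 ∈ cellBox d j := by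
  rw [cellBox, Fintype.mem_piFinset]
  intro i
  have h1 : |x i| < 2 ^ shell x := (norm_le_pi_norm (WithLp.ofLp x) i).trans_lt
    (norm_lt_two_pow_shell x)
  rw [abs_lt] at h1
  have h2 : (0 : ℝ) < 2 ^ shell x := by positivity
  have h3 : (0 : ℝ) < 2 ^ j := by positivity
  rw [Finset.mem_Ico]
  constructor
  · refine Int.le_floor.2 ?_
    rw [le_div_iff₀ h2]; push_cast; nlinarith
  · refine Int.floor_lt.2 ?_
    rw [div_lt_iff₀ h2]; push_cast; nlinarith

theorem preimage_cell_eq_empty {j m : ℕ} {k : Fin d → ℤ} (hk : k ∉ cellBox d j) :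
    cell j ⁻¹' {(m, k)} = (∅ : Set (EuclideanSpace ℝ (Fin d))) := by
  ext x
  simp only [Set.mem_preimage, Set.mem_singleton_iff, Set.mem_empty_iff_false, iff_false]
  intro h
  exact hk (by have := cell_snd_mem j x; rwa [h] at this)

theorem dist_le_of_forall_abs_le {x y : EuclideanSpace ℝ (Fin d)} {b : ℝ} (hb : 0 ≤ b)
    (h : ∀ i, |x i - y i| ≤ b) : dist x y ≤ d * b := by
  rw [EuclideanSpace.dist_eq]
  refine Real.sqrt_le_iff.2 ⟨by positivity, ?_⟩
  calc ∑ i, dist (x i) (y i) ^ 2 ≤ ∑ _i : Fin d, b ^ 2 :=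
        Finset.sum_le_sum fun i _ => pow_le_pow_left₀ dist_nonneg (h i) 2
    _ = d * b ^ 2 := by simp
    _ ≤ (d * b) ^ 2 := by
        rw [mul_pow]
        gcongr
        rcases Nat.eq_zero_or_pos d with h | h
        · simp [h]
        · have : (1 : ℝ) ≤ d := by exact_mod_cast h
          nlinarith

theorem edist_le_of_forall_abs_le {x y : EuclideanSpace ℝ (Fin d)} {t : ℝ}
    (h : ∀ i, |x i - y i| ≤ 2 ^ t) : edist x y ≤ d * pow2 t := by
  rw [edist_dist, pow2_eq_ofReal, ← ENNReal.ofReal_natCast, ← ENNReal.ofReal_mul (by positivity)]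
  exact ENNReal.ofReal_le_ofReal (dist_le_of_forall_abs_le (by positivity) h)

/-- The side is 2^(m-j); writing it as 2 · 2^(m-(j+1)) gives the index shift required by
`exists_coupling_le`, at the price of the factor 2^p. -/
theorem edist_rpow_le_of_cell_eq {p : ℝ} (hp : 0 ≤ p) {j : ℕ} {x y : EuclideanSpace ℝ (Fin d)}
    (h : cell j x = cell j y) :
    edist x y ^ p ≤ (2 * d) ^ p * pow2 (p * ((shell x : ℝ) - ((j + 1 : ℕ) : ℝ))) := by
  have hs : shell y = shell x := (congrArg Prod.fst h).symm
  have hi : ∀ i, |x i - y i| ≤ 2 ^ ((shell x : ℝ) - j) := by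
    intro i
    have h1 : ⌊2 ^ j * x i / 2 ^ shell x⌋ = ⌊2 ^ j * y i / 2 ^ shell x⌋ := by
      have := congrFun (congrArg Prod.snd h) i
      simpa [cell, hs] using this
    have h2 := (Int.abs_sub_lt_one_of_floor_eq_floor h1).le
    have h3 : (2 : ℝ) ^ j * x i / 2 ^ shell x - 2 ^ j * y i / 2 ^ shell x =
        2 ^ j / 2 ^ shell x * (x i - y i) := by ring
    have h4 : (0 : ℝ) < 2 ^ j / 2 ^ shell x := by positivity
    rw [h3, abs_mul, abs_of_pos h4] at h2
    rw [Real.rpow_sub two_pos, Real.rpow_natCast, Real.rpow_natCast, le_div_iff₀ (by positivity)]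
    rw [div_mul_eq_mul_div, div_le_one (by positivity)] at h2
    linarith
  have := edist_le_of_forall_abs_le hi
  rw [mul_comm p, pow2_mul, ← ENNReal.mul_rpow_of_nonneg _ _ hp]
  refine ENNReal.rpow_le_rpow (this.trans (le_of_eq ?_)) hp
  have e : ((shell x : ℝ) - j) = 1 + ((shell x : ℝ) - ((j + 1 : ℕ) : ℝ)) := by push_cast; ring
  rw [e, pow2_add, pow2_one]; ring

theorem add_rpow_le_two_rpow_mul {p : ℝ} (hp : 0 ≤ p) (a b : ℝ≥0∞) :
    (a + b) ^ p ≤ 2 ^ p * (a ^ p + b ^ p) := by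
  wlog h : a ≤ b generalizing a b
  · rw [add_comm a, add_comm (a ^ p)]; exact this b a (le_of_not_ge h)
  calc (a + b) ^ p ≤ (2 * b) ^ p := ENNReal.rpow_le_rpow (by rw [two_mul]; gcongr) hp
    _ = 2 ^ p * b ^ p := ENNReal.mul_rpow_of_nonneg _ _ hp
    _ ≤ _ := by gcongr; exact le_add_self

theorem edist_rpow_le_add {p : ℝ} (hp : 0 ≤ p) (x y : EuclideanSpace ℝ (Fin d)) :
    edist x y ^ p ≤ (2 * d) ^ p * pow2 (p * shell x) + (2 * d) ^ p * pow2 (p * shell y) := by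
  have hz : ∀ z : EuclideanSpace ℝ (Fin d), edist z 0 ≤ d * pow2 (shell z) := fun z => by
    refine edist_le_of_forall_abs_le fun i => ?_
    rw [Real.rpow_natCast]
    simpa using (norm_le_pi_norm (WithLp.ofLp z) i).trans (norm_lt_two_pow_shell z).le
  calc edist x y ^ p ≤ (edist x 0 + edist y 0) ^ p :=
        ENNReal.rpow_le_rpow (edist_triangle_right _ _ _) hp
    _ ≤ (d * pow2 (shell x) + d * pow2 (shell y)) ^ p :=
        ENNReal.rpow_le_rpow (add_le_add (hz x) (hz y)) hp
    _ ≤ 2 ^ p * ((d * pow2 (shell x)) ^ p + (d * pow2 (shell y)) ^ p) :=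
        add_rpow_le_two_rpow_mul hp _ _
    _ = _ := by
        rw [ENNReal.mul_rpow_of_nonneg _ _ hp, ENNReal.mul_rpow_of_nonneg _ _ hp,
          ENNReal.mul_rpow_of_nonneg _ _ hp, mul_comm p, pow2_mul, mul_comm p, pow2_mul]
        ring

end Cells

/-! ### The deterministic multiscale bound for the empirical measure. -/

section Empirical

variable {d : ℕ}

/-- The centered number of visits of a cell by the first `n` points. -/
noncomputable def centeredCount (μ : Measure (EuclideanSpace ℝ (Fin d)))
    (x : ℕ → EuclideanSpace ℝ (Fin d)) (F : Set (EuclideanSpace ℝ (Fin d))) (n : ℕ) : ℝ :=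
  ∑ l ∈ Finset.range n, (F.indicator 1 (x l) - μ.real F)

/-- The total discrepancy over the cells of generation `j` in the shell `m`. -/
noncomputable def cellGap (μ : Measure (EuclideanSpace ℝ (Fin d)))
    (x : ℕ → EuclideanSpace ℝ (Fin d)) (m j n : ℕ) : ℝ≥0∞ :=
  ∑ k ∈ cellBox d j, ENNReal.ofReal |centeredCount μ x (cell j ⁻¹' {(m, k)}) n|

theorem gap_ofReal {a b : ℝ} (ha : 0 ≤ a) (hb : 0 ≤ b) :
    gap (ENNReal.ofReal a) (ENNReal.ofReal b) = ENNReal.ofReal |a - b| := by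
  rw [gap, ← ENNReal.ofReal_sub _ hb, ← ENNReal.ofReal_sub _ ha]
  rcases le_total a b with h | h
  · rw [ENNReal.ofReal_of_nonpos (sub_nonpos.2 h), zero_add, abs_sub_comm,
      abs_of_nonneg (sub_nonneg.2 h)]
  · rw [ENNReal.ofReal_of_nonpos (sub_nonpos.2 h), add_zero, abs_of_nonneg (sub_nonneg.2 h)]

theorem isProbabilityMeasure_empiricalMeasure {E : Type*} [MeasurableSpace E] (x : ℕ → E) {n : ℕ}
    (hn : n ≠ 0) : IsProbabilityMeasure (empiricalMeasure x n) := by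
  refine ⟨?_⟩
  simp only [empiricalMeasure, Measure.smul_apply, Measure.coe_finsetSum, Finset.sum_apply,
    measure_univ, Finset.sum_const, Finset.card_range, smul_eq_mul, nsmul_eq_mul, mul_one]
  exact ENNReal.inv_mul_cancel (by simpa using hn) (by simp)

theorem lintegral_empiricalMeasure {E : Type*} [MeasurableSpace E] (x : ℕ → E) (n : ℕ)
    {f : E → ℝ≥0∞} (hf : Measurable f) :
    ∫⁻ y, f y ∂(empiricalMeasure x n) = (n : ℝ≥0∞)⁻¹ * ∑ l ∈ Finset.range n, f (x l) := by
  rw [empiricalMeasure, lintegral_smul_measure, lintegral_finsetSum_measure]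
  simp [lintegral_dirac' _ hf]

theorem mul_gap_empiricalMeasure (μ : Measure (EuclideanSpace ℝ (Fin d))) [IsProbabilityMeasure μ]
    (x : ℕ → EuclideanSpace ℝ (Fin d)) {F : Set (EuclideanSpace ℝ (Fin d))} (hF : MeasurableSet F)
    {n : ℕ} (hn : n ≠ 0) :
    n * gap (empiricalMeasure x n F) (μ F) = ENNReal.ofReal |centeredCount μ x F n| := by
  have hn' : (0 : ℝ) < n := by positivity
  have hind : ∀ l ∈ Finset.range n,
      0 ≤ F.indicator (1 : EuclideanSpace ℝ (Fin d) → ℝ) (x l) :=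
    fun l _ => Set.indicator_nonneg (fun _ _ => zero_le_one) _
  have h0 := Finset.sum_nonneg hind
  have h1 : empiricalMeasure x n F = ENNReal.ofReal ((n : ℝ)⁻¹ *
      ∑ l ∈ Finset.range n, F.indicator (1 : EuclideanSpace ℝ (Fin d) → ℝ) (x l)) := by
    rw [← lintegral_indicator_one hF, lintegral_empiricalMeasure _ _
      (measurable_one.indicator hF), ENNReal.ofReal_mul (by positivity),
      ENNReal.ofReal_inv_of_pos hn', ENNReal.ofReal_natCast, ENNReal.ofReal_sum_of_nonneg
      hind]
    congr 1
    refine Finset.sum_congr rfl fun l _ => ?_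
    by_cases h : x l ∈ F <;> simp [h]
  have h2 : μ F = ENNReal.ofReal (μ.real F) := by simp
  rw [h1, h2, gap_ofReal (by positivity) measureReal_nonneg, ← ENNReal.ofReal_natCast,
    ← ENNReal.ofReal_mul hn'.le]
  congr 1
  have habs : ∀ a : ℝ, (n : ℝ) * |a| = |n * a| := fun a => by rw [abs_mul, abs_of_pos hn']
  rw [habs, centeredCount, Finset.sum_sub_distrib]
  congr 1
  simp only [Finset.sum_const, Finset.card_range, nsmul_eq_mul]
  field_simp

theorem mul_wassersteinPow_empiricalMeasure_le {p : ℝ} (hp : 0 < p)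
    (μ : Measure (EuclideanSpace ℝ (Fin d))) [IsProbabilityMeasure μ]
    (x : ℕ → EuclideanSpace ℝ (Fin d)) {n : ℕ} (hn : n ≠ 0) :
    n * wassersteinPow p (empiricalMeasure x n) μ ≤
      (2 * d) ^ p * ∑' m : ℕ, ∑' j : ℕ, pow2 (p * ((m : ℝ) - j)) * cellGap μ x m j n := by
  have := isProbabilityMeasure_empiricalMeasure x hn
  set C : ℝ≥0∞ := (2 * d) ^ p with hC
  have hCtop : C ≠ ∞ := ENNReal.rpow_ne_top_of_nonneg hp.le (by finiteness)
  set w : ℕ → ℕ × (Fin d → ℤ) → ℝ≥0∞ := fun j i => C * pow2 (p * ((i.1 : ℝ) - j)) with hw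
  have hn0 : (n : ℝ≥0∞) ≠ 0 := by simpa using hn
  have key : ∀ J : ℕ, n * wassersteinPow p (empiricalMeasure x n) μ ≤
      (∑ l ∈ Finset.range n, C * pow2 (p * shell (x l))) * pow2 (-p) ^ (J + 1) +
      C * ∑' m : ℕ, ∑' j : ℕ, pow2 (p * ((m : ℝ) - j)) * cellGap μ x m j n := by
    intro J
    -- With the empirical measure as first margin, the remainder is a finite sum over the sample
    -- points, so it is finite without any moment and vanishes as J → ∞.
    obtain ⟨π, hπ, hc⟩ := exists_coupling_le (μ := empiricalMeasure x n) (ν := μ)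
      (T := cell (d := d)) measurable_cell _ halve_comp_cell w (fun z => edist z.1 z.2 ^ p)
      (fun x y => by simpa [hw, cell] using edist_rpow_le_add hp.le x y)
      (fun j x y h => edist_rpow_le_of_cell_eq hp.le h) J
    calc n * wassersteinPow p (empiricalMeasure x n) μ
        ≤ n * ∫⁻ z, edist z.1 z.2 ^ p ∂π := by
          gcongr; exact iInf₂_le π hπ
      _ ≤ _ := mul_le_mul_right hc _
      _ ≤ _ := by
        rw [mul_add]
        refine add_le_add (le_of_eq ?_) ?_
        · rw [lintegral_empiricalMeasure _ _ (f := fun y => w (J + 1) (cell (J + 1) y))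
              (Measurable.comp (g := w (J + 1)) (measurable_of_countable _) (measurable_cell _)),
            ← mul_assoc, ENNReal.mul_inv_cancel hn0 (by simp), one_mul, Finset.sum_mul]
          refine Finset.sum_congr rfl fun l _ => ?_
          rw [← pow2_mul_natCast, mul_assoc, ← pow2_add]
          simp only [hw, cell]
          congr 2; ring
        · calc (n : ℝ≥0∞) * ∑ j ∈ Finset.range (J + 1), ∑' i, w j i *
                gap (empiricalMeasure x n (cell j ⁻¹' {i})) (μ (cell j ⁻¹' {i}))
              = ∑ j ∈ Finset.range (J + 1), C * ∑' m : ℕ,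
                pow2 (p * ((m : ℝ) - j)) * cellGap μ x m j n := by
                rw [Finset.mul_sum]
                refine Finset.sum_congr rfl fun j _ => ?_
                rw [ENNReal.tsum_prod', ← ENNReal.tsum_mul_left, ← ENNReal.tsum_mul_left]
                refine tsum_congr fun m => ?_
                rw [tsum_eq_sum (s := cellBox d j), cellGap, Finset.mul_sum, Finset.mul_sum,
                  Finset.mul_sum]
                · refine Finset.sum_congr rfl fun k _ => ?_
                  rw [← mul_gap_empiricalMeasure μ x
                    (measurable_cell j (measurableSet_singleton _)) hn]
                  simp only [hw]
                  ring
                · intro k hk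
                  rw [preimage_cell_eq_empty hk]
                  simp [gap]
            _ ≤ ∑' j : ℕ, C * ∑' m : ℕ, pow2 (p * ((m : ℝ) - j)) * cellGap μ x m j n :=
                ENNReal.sum_le_tsum _
            _ = _ := by rw [ENNReal.tsum_mul_left, ENNReal.tsum_comm]
  have hlim : Tendsto (fun J : ℕ =>
      (∑ l ∈ Finset.range n, C * pow2 (p * shell (x l))) * pow2 (-p) ^ (J + 1) +
      C * ∑' m : ℕ, ∑' j : ℕ, pow2 (p * ((m : ℝ) - j)) * cellGap μ x m j n) atTop
      (𝓝 (0 + C * ∑' m : ℕ, ∑' j : ℕ, pow2 (p * ((m : ℝ) - j)) * cellGap μ x m j n)) := by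
    refine Tendsto.add ?_ tendsto_const_nhds
    have h1 := (ENNReal.tendsto_pow_atTop_nhds_zero_of_lt_one
      (pow2_lt_one (x := -p) (by linarith))).comp (tendsto_add_atTop_nat 1)
    have h2 := ENNReal.Tendsto.const_mul (a := ∑ l ∈ Finset.range n, C * pow2 (p * shell (x l))) h1
      (Or.inr (ENNReal.sum_ne_top.2 fun l _ => ENNReal.mul_ne_top hCtop (pow2_ne_top _)))
    simpa using h2
  rw [zero_add] at hlim
  exact ge_of_tendsto' hlim key

end Empirical

/-! ### Trivial and second-moment bounds on the cell discrepancies. -/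

section Bounds

variable {d : ℕ}

/-- The sum of the (unnormalized) empirical measure of `n` points and of `n` times `μ`. -/
noncomputable def totalMeasure (μ : Measure (EuclideanSpace ℝ (Fin d)))
    (x : ℕ → EuclideanSpace ℝ (Fin d)) (n : ℕ) : Measure (EuclideanSpace ℝ (Fin d)) :=
  ∑ l ∈ Finset.range n, Measure.dirac (x l) + (n : ℝ≥0∞) • μ

theorem totalMeasure_apply (μ : Measure (EuclideanSpace ℝ (Fin d)))
    (x : ℕ → EuclideanSpace ℝ (Fin d)) (n : ℕ) (F : Set (EuclideanSpace ℝ (Fin d))) :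
    totalMeasure μ x n F = ∑ l ∈ Finset.range n, Measure.dirac (x l) F + n * μ F := by
  simp [totalMeasure]

theorem totalMeasure_mono (μ : Measure (EuclideanSpace ℝ (Fin d)))
    (x : ℕ → EuclideanSpace ℝ (Fin d)) {n N : ℕ} (h : n ≤ N)
    (F : Set (EuclideanSpace ℝ (Fin d))) :
    totalMeasure μ x n F ≤ totalMeasure μ x N F := by
  rw [totalMeasure_apply, totalMeasure_apply]
  gcongr

theorem ofReal_abs_centeredCount_le (μ : Measure (EuclideanSpace ℝ (Fin d)))
    [IsProbabilityMeasure μ] (x : ℕ → EuclideanSpace ℝ (Fin d))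
    {F : Set (EuclideanSpace ℝ (Fin d))} (hF : MeasurableSet F) (n : ℕ) :
    ENNReal.ofReal |centeredCount μ x F n| ≤ totalMeasure μ x n F := by
  have h0 : ∀ l, 0 ≤ F.indicator (1 : EuclideanSpace ℝ (Fin d) → ℝ) (x l) :=
    fun l => Set.indicator_nonneg (fun _ _ => zero_le_one) _
  have h1 : |centeredCount μ x F n| ≤ ∑ l ∈ Finset.range n, (F.indicator 1 (x l) + μ.real F) := by
    refine (Finset.abs_sum_le_sum_abs _ _).trans (Finset.sum_le_sum fun l _ => ?_)
    refine (abs_sub _ _).trans (le_of_eq ?_)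
    rw [abs_of_nonneg measureReal_nonneg, abs_of_nonneg (h0 l)]
  refine (ENNReal.ofReal_le_ofReal h1).trans (le_of_eq ?_)
  rw [ENNReal.ofReal_sum_of_nonneg fun l _ => add_nonneg (h0 l) measureReal_nonneg,
    totalMeasure_apply]
  simp_rw [ENNReal.ofReal_add (h0 _) measureReal_nonneg]
  rw [Finset.sum_add_distrib]
  congr 1
  · refine Finset.sum_congr rfl fun l _ => ?_
    rw [Measure.dirac_apply' _ hF]
    by_cases h : x l ∈ F <;> simp [h]
  · simp

theorem sum_measure_cell_le (γ : Measure (EuclideanSpace ℝ (Fin d))) (m j : ℕ) :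
    ∑ k ∈ cellBox d j, γ (cell j ⁻¹' {(m, k)}) ≤ γ (shell ⁻¹' {m}) := by
  rw [← measure_biUnion_finset]
  · refine measure_mono (Set.iUnion₂_subset fun _ _ x hx => ?_)
    exact congrArg Prod.fst hx
  · intro k _ k' _ hkk
    refine Disjoint.preimage _ ?_
    simpa using hkk
  · exact fun k _ => measurable_cell j (measurableSet_singleton _)

theorem cellGap_le_totalMeasure (μ : Measure (EuclideanSpace ℝ (Fin d))) [IsProbabilityMeasure μ]
    (x : ℕ → EuclideanSpace ℝ (Fin d)) (m j : ℕ) {n N : ℕ} (h : n ≤ N) :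
    cellGap μ x m j n ≤ totalMeasure μ x N (shell ⁻¹' {m}) :=
  calc cellGap μ x m j n ≤ ∑ k ∈ cellBox d j, totalMeasure μ x n (cell j ⁻¹' {(m, k)}) :=
        Finset.sum_le_sum fun _ _ => ofReal_abs_centeredCount_le μ x
          (measurable_cell j (measurableSet_singleton _)) n
    _ ≤ totalMeasure μ x n (shell ⁻¹' {m}) := sum_measure_cell_le _ _ _
    _ ≤ _ := totalMeasure_mono μ x h _

/-- The sum over the cells of the maximal discrepancies up to time `n`. -/
noncomputable def cellGapMax (μ : Measure (EuclideanSpace ℝ (Fin d)))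
    (x : ℕ → EuclideanSpace ℝ (Fin d)) (m j n : ℕ) : ℝ≥0∞ :=
  ∑ k ∈ cellBox d j,
    ENNReal.ofReal (partialSups (fun i => |centeredCount μ x (cell j ⁻¹' {(m, k)}) i|) n)

theorem cellGap_le_cellGapMax (μ : Measure (EuclideanSpace ℝ (Fin d)))
    (x : ℕ → EuclideanSpace ℝ (Fin d)) (m j : ℕ) {n N : ℕ} (h : n ≤ N) :
    cellGap μ x m j n ≤ cellGapMax μ x m j N :=
  Finset.sum_le_sum fun k _ => ENNReal.ofReal_le_ofReal
    (le_partialSups_of_le (fun i => |centeredCount μ x (cell j ⁻¹' {(m, k)}) i|) h)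

theorem lintegral_pow2_shell_ne_top {q : ℝ} (hq : 0 ≤ q)
    (μ : Measure (EuclideanSpace ℝ (Fin d))) [IsProbabilityMeasure μ]
    (h : strongMoment q μ < ∞) : ∫⁻ x, pow2 (q * shell x) ∂μ ≠ ∞ := by
  have hle : ∀ x : EuclideanSpace ℝ (Fin d),
      pow2 (q * shell x) ≤ 1 + 2 ^ q * ‖WithLp.ofLp x‖ₑ ^ q := by
    intro x
    have h1 : pow2 (shell x) ≤ max 1 (2 * ‖WithLp.ofLp x‖ₑ) := by
      rw [pow2_eq_ofReal, Real.rpow_natCast]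
      refine (ENNReal.ofReal_le_ofReal (two_pow_shell_le x)).trans (le_of_eq ?_)
      rw [ENNReal.ofReal_max, ENNReal.ofReal_mul two_pos.le, ofReal_norm]
      simp
    rw [mul_comm, pow2_mul]
    refine (ENNReal.rpow_le_rpow h1 hq).trans ?_
    rcases le_total 1 (2 * ‖WithLp.ofLp x‖ₑ) with h | h
    · rw [max_eq_right h, ENNReal.mul_rpow_of_nonneg _ _ hq]; exact le_add_self
    · rw [max_eq_left h, ENNReal.one_rpow]; exact le_self_add
  refine ne_top_of_le_ne_top ?_ (lintegral_mono hle)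
  rw [lintegral_add_left measurable_const, lintegral_const_mul' _ _ (by
    exact ENNReal.rpow_ne_top_of_nonneg hq ENNReal.ofNat_ne_top)]
  simp only [lintegral_one, measure_univ]
  exact ENNReal.add_ne_top.2 ⟨ENNReal.one_ne_top,
    ENNReal.mul_ne_top (ENNReal.rpow_ne_top_of_nonneg hq ENNReal.ofNat_ne_top) h.ne⟩

theorem lintegral_comp_shell (γ : Measure (EuclideanSpace ℝ (Fin d))) (c : ℕ → ℝ≥0∞) :
    ∫⁻ x, c (shell x) ∂γ = ∑' m, c m * γ (shell ⁻¹' {m}) :=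
  lintegral_comp_countable γ measurable_shell c

variable {Ω : Type*} [MeasurableSpace Ω] {P : Measure Ω} {μ : Measure (EuclideanSpace ℝ (Fin d))}
  {X : ℕ → Ω → EuclideanSpace ℝ (Fin d)}

theorem measurable_totalMeasure (hX : ∀ k, Measurable (X k)) (n : ℕ)
    {F : Set (EuclideanSpace ℝ (Fin d))} (hF : MeasurableSet F) :
    Measurable fun ω => totalMeasure μ (fun k => X k ω) n F := by
  simp_rw [totalMeasure_apply, Measure.dirac_apply' _ hF]
  refine Measurable.add_const (Finset.measurable_sum _ fun l _ => ?_) _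
  exact (measurable_one.indicator hF).comp (hX l)

theorem measurable_centeredCount_term (hX : ∀ k, Measurable (X k))
    {F : Set (EuclideanSpace ℝ (Fin d))} (hF : MeasurableSet F) (k : ℕ) :
    Measurable fun ω => F.indicator (1 : EuclideanSpace ℝ (Fin d) → ℝ) (X k ω) - μ.real F :=
  ((measurable_one.indicator hF).comp (hX k)).sub_const _

theorem measurable_partialSups_centeredCount (hX : ∀ k, Measurable (X k))
    {F : Set (EuclideanSpace ℝ (Fin d))} (hF : MeasurableSet F) (n : ℕ) :
    Measurable fun ω => partialSups (fun i => |centeredCount μ (fun k => X k ω) F i|) n :=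
  measurable_partialSups_abs_sum n fun k _ => measurable_centeredCount_term hX hF k

theorem measurable_cellGapMax (hX : ∀ k, Measurable (X k)) (m j n : ℕ) :
    Measurable fun ω => cellGapMax μ (fun k => X k ω) m j n :=
  Finset.measurable_sum _ fun k _ => (measurable_partialSups_centeredCount hX
    (measurable_cell j (measurableSet_singleton (m, k))) n).ennreal_ofReal

variable [IsProbabilityMeasure P]

theorem lintegral_totalMeasure (hX : ∀ k, Measurable (X k)) (hlaw : ∀ k, P.map (X k) = μ) (n : ℕ)
    {F : Set (EuclideanSpace ℝ (Fin d))} (hF : MeasurableSet F) :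
    ∫⁻ ω, totalMeasure μ (fun k => X k ω) n F ∂P = 2 * n * μ F := by
  have h1 : ∀ l, Measurable fun ω => Measure.dirac (X l ω) F := fun l => by
    simp_rw [Measure.dirac_apply' _ hF]
    exact (measurable_one.indicator hF).comp (hX l)
  have h2 : ∀ l, ∫⁻ ω, Measure.dirac (X l ω) F ∂P = μ F := fun l => by
    simp_rw [Measure.dirac_apply' _ hF]
    rw [← lintegral_map (f := F.indicator 1) (measurable_one.indicator hF) (hX l), hlaw,
      lintegral_indicator_one hF]
  simp_rw [totalMeasure_apply]
  rw [lintegral_add_right _ measurable_const, lintegral_finsetSum _ fun l _ => h1 l]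
  simp_rw [h2]
  simp only [Finset.sum_const, Finset.card_range, nsmul_eq_mul, lintegral_const, measure_univ]
  ring

variable [IsProbabilityMeasure μ]

theorem lintegral_sq_partialSups_centeredCount_le (hX : ∀ k, Measurable (X k))
    (hind : iIndepFun X P) (hlaw : ∀ k, P.map (X k) = μ)
    {F : Set (EuclideanSpace ℝ (Fin d))} (hF : MeasurableSet F) (n : ℕ) :
    ∫⁻ ω, ENNReal.ofReal (partialSups
      (fun i => |centeredCount μ (fun k => X k ω) F i|) n) ^ 2 ∂P ≤ 4 * n * μ F := by
  set Y : ℕ → Ω → ℝ := fun k ω => F.indicator 1 (X k ω) - μ.real F with hY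
  have hYm : ∀ k, Measurable (Y k) := measurable_centeredCount_term hX hF
  have hFm : Measurable (F.indicator (1 : EuclideanSpace ℝ (Fin d) → ℝ)) :=
    measurable_one.indicator hF
  have hμ1 : μ.real F ≤ 1 := measureReal_le_one
  have hμ0 : 0 ≤ μ.real F := measureReal_nonneg
  have hK : ∀ k ω, |Y k ω| ≤ 1 := by
    intro k ω
    simp only [hY]
    by_cases h : X k ω ∈ F
    · simp only [h, Set.indicator_of_mem, Pi.one_apply]
      rw [abs_le]; constructor <;> linarith
    · simp only [h, not_false_eq_true, Set.indicator_of_notMem]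
      rw [abs_le]; constructor <;> linarith
  have hYind : iIndepFun Y P := by
    have := hind.comp (fun _ x => F.indicator (1 : EuclideanSpace ℝ (Fin d) → ℝ) x - μ.real F)
      (fun _ => hFm.sub_const _)
    exact this
  have hint : ∀ k (c : ℝ → ℝ), Measurable c → ∫ ω, c (F.indicator 1 (X k ω)) ∂P =
      ∫ x, c (F.indicator 1 x) ∂μ := by
    intro k c hc
    rw [← hlaw k, integral_map (hX k).aemeasurable]
    exact (hc.comp hFm).aestronglyMeasurable
  have hindi : Integrable (F.indicator (1 : EuclideanSpace ℝ (Fin d) → ℝ)) μ :=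
    (integrable_const (1 : ℝ)).indicator hF
  have hone : ∫ x, F.indicator (1 : EuclideanSpace ℝ (Fin d) → ℝ) x ∂μ = μ.real F :=
    integral_indicator_one hF
  have h0 : ∀ k, ∫ ω, Y k ω ∂P = 0 := by
    intro k
    rw [hint k (fun t => t - μ.real F) (by fun_prop), integral_sub hindi (integrable_const _), hone]
    simp
  have hv : ∀ k, ∫ ω, Y k ω ^ 2 ∂P ≤ μ.real F := by
    intro k
    rw [hint k (fun t => (t - μ.real F) ^ 2) (by fun_prop)]
    have e : ∀ x, (F.indicator (1 : EuclideanSpace ℝ (Fin d) → ℝ) x - μ.real F) ^ 2 =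
        (1 - 2 * μ.real F) * F.indicator 1 x + μ.real F ^ 2 := by
      intro x
      by_cases h : x ∈ F
      · simp [h]; ring
      · simp [h]
    simp_rw [e]
    rw [integral_add (hindi.const_mul _) (integrable_const _), integral_const_mul, hone]
    simp
    nlinarith
  have h := integral_sq_partialSups_le hYm hYind hK h0 hv n
  have hm : Measurable fun ω => partialSups (fun i => |∑ k ∈ Finset.range i, Y k ω|) n :=
    measurable_partialSups_abs_sum n fun k _ => hYm k
  have hnn : ∀ ω, 0 ≤ partialSups (fun i => |∑ k ∈ Finset.range i, Y k ω|) n := fun ω =>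
    (abs_nonneg _).trans (le_partialSups (fun i => |∑ k ∈ Finset.range i, Y k ω|) n)
  have hi : Integrable
      (fun ω => (partialSups (fun i => |∑ k ∈ Finset.range i, Y k ω|) n) ^ 2) P := by
    refine Integrable.of_bound (hm.pow_const 2).aestronglyMeasurable ((n * 1) ^ 2)
      (Eventually.of_forall fun ω => ?_)
    rw [Real.norm_eq_abs, abs_pow, abs_of_nonneg (hnn ω)]
    exact pow_le_pow_left₀ (hnn ω) (partialSups_abs_sum_le (fun k => hK k ω) n) 2
  calc _ = ∫⁻ ω, ENNReal.ofReal
        ((partialSups (fun i => |∑ k ∈ Finset.range i, Y k ω|) n) ^ 2) ∂P :=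
        lintegral_congr fun ω => (ENNReal.ofReal_pow (hnn ω) 2).symm
    _ = ENNReal.ofReal (∫ ω, (partialSups (fun i => |∑ k ∈ Finset.range i, Y k ω|) n) ^ 2 ∂P) :=
        (ofReal_integral_eq_lintegral_ofReal hi (Eventually.of_forall fun ω => sq_nonneg _)).symm
    _ ≤ ENNReal.ofReal (4 * (n * μ.real F)) := ENNReal.ofReal_le_ofReal h
    _ = 4 * n * μ F := by
        rw [ENNReal.ofReal_mul (by norm_num), ENNReal.ofReal_mul (by positivity)]
        simp [mul_assoc]

/-- Cauchy–Schwarz costs the number 2^(d(j+1)) of cells; the variances of the cell counts then add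
up to at most n times the mass of the shell. -/
theorem lintegral_sq_cellGapMax_le (hX : ∀ k, Measurable (X k))
    (hind : iIndepFun X P) (hlaw : ∀ k, P.map (X k) = μ) (m j n : ℕ) :
    ∫⁻ ω, cellGapMax μ (fun k => X k ω) m j n ^ 2 ∂P ≤
      pow2 (d * (j + 1)) * (4 * n * μ (shell ⁻¹' {m})) := by
  have hF : ∀ k, MeasurableSet (cell (d := d) j ⁻¹' {(m, k)}) := fun k =>
    measurable_cell j (measurableSet_singleton _)
  calc ∫⁻ ω, cellGapMax μ (fun k => X k ω) m j n ^ 2 ∂P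
      ≤ ∫⁻ ω, (cellBox d j).card * ∑ k ∈ cellBox d j, ENNReal.ofReal (partialSups
          (fun i => |centeredCount μ (fun k => X k ω) (cell j ⁻¹' {(m, k)}) i|) n) ^ 2 ∂P :=
        lintegral_mono fun ω => sq_sum_le_card_mul _ _
    _ = (cellBox d j).card * ∑ k ∈ cellBox d j, ∫⁻ ω, ENNReal.ofReal (partialSups
          (fun i => |centeredCount μ (fun k => X k ω) (cell j ⁻¹' {(m, k)}) i|) n) ^ 2 ∂P := by
        rw [lintegral_const_mul' _ _ (by simp), lintegral_finsetSum]
        exact fun k _ =>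
          (measurable_partialSups_centeredCount hX (hF k) n).ennreal_ofReal.pow_const 2
    _ ≤ (cellBox d j).card * ∑ k ∈ cellBox d j, 4 * n * μ (cell j ⁻¹' {(m, k)}) := by
        gcongr with k _
        exact lintegral_sq_partialSups_centeredCount_le hX hind hlaw (hF k) n
    _ ≤ _ := by
        rw [← Finset.mul_sum, card_cellBox]
        gcongr
        exact sum_measure_cell_le _ _ _

end Bounds

/-! ### Geometric series on one side of a threshold. -/

section Geometric

/-- Used with φ n the distance from n to the threshold; the bound does not depend on where the
threshold lies. -/
theorem tsum_ite_le_of_injOn {S : ℕ → Prop} [DecidablePred S] {f : ℕ → ℝ≥0∞} {φ : ℕ → ℕ}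
    {q : ℝ≥0∞} (hφ : ∀ n n', S n → S n' → φ n = φ n' → n = n') (hf : ∀ n, S n → f n ≤ q ^ φ n) :
    ∑' n, (if S n then f n else 0) ≤ (1 - q)⁻¹ := by
  have hinj : Function.Injective fun n : {n | S n} => φ n := fun a b h =>
    Subtype.ext (hφ a b a.2 b.2 h)
  calc ∑' n, (if S n then f n else 0) = ∑' n, Set.indicator {n | S n} f n :=
        tsum_congr fun n => by simp [Set.indicator_apply]
    _ = ∑' n : {n | S n}, f n := (tsum_subtype _ _).symm
    _ ≤ ∑' n : {n | S n}, q ^ φ n := ENNReal.tsum_le_tsum fun n => hf n n.2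
    _ ≤ ∑' i, q ^ i := ENNReal.tsum_comp_le_tsum_of_injective hinj (fun i => q ^ i)
    _ = (1 - q)⁻¹ := ENNReal.tsum_geometric q

theorem inv_one_sub_pow2_ne_top {x : ℝ} (h : x < 0) : (1 - pow2 x)⁻¹ ≠ ∞ := by
  rw [Ne, ENNReal.inv_eq_top, tsub_eq_zero_iff_le, not_le]
  exact pow2_lt_one h

theorem exists_tsum_pow2_below_le {a b : ℝ} (ha : 0 < a) (hb : 0 < b) :
    ∃ C ≠ ∞, ∀ y : ℝ, ∑' n : ℕ, (if b * n ≤ y then pow2 (a * (b * n - y)) else 0) ≤ C := by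
  have hab : -(a * b) < 0 := by have := mul_pos ha hb; linarith
  refine ⟨_, inv_one_sub_pow2_ne_top hab, fun y => ?_⟩
  have hle : ∀ n : ℕ, b * n ≤ y → n ≤ ⌊y / b⌋₊ := fun n hn =>
    Nat.le_floor ((le_div_iff₀ hb).2 (by linarith))
  refine tsum_ite_le_of_injOn (φ := fun n => ⌊y / b⌋₊ - n) ?_ ?_
  · intro n n' hn hn' h
    have h1 := hle n hn; have h2 := hle n' hn'
    omega
  · intro n hn
    rw [← pow2_mul_natCast]
    refine pow2_mono ?_
    have h1 := hle n hn
    push_cast [Nat.cast_sub h1]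
    have hy : 0 ≤ y := le_trans (by positivity) hn
    have h2 : b * (⌊y / b⌋₊ : ℝ) ≤ y := by
      rw [mul_comm, ← le_div_iff₀ hb]; exact Nat.floor_le (by positivity)
    have h3 := mul_le_mul_of_nonneg_left h2 ha.le
    nlinarith

theorem exists_tsum_pow2_above_le {a b : ℝ} (ha : 0 < a) (hb : 0 < b) :
    ∃ C ≠ ∞, ∀ y : ℝ, ∑' n : ℕ, (if y ≤ b * n then pow2 (a * (y - b * n)) else 0) ≤ C := by
  have hab : -(a * b) < 0 := by have := mul_pos ha hb; linarith
  refine ⟨_, inv_one_sub_pow2_ne_top hab, fun y => ?_⟩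
  have hle : ∀ n : ℕ, y ≤ b * n → ⌈y / b⌉₊ ≤ n := fun n hn =>
    Nat.ceil_le.2 ((div_le_iff₀ hb).2 (by linarith))
  refine tsum_ite_le_of_injOn (φ := fun n => n - ⌈y / b⌉₊) ?_ ?_
  · intro n n' hn hn' h
    have h1 := hle n hn; have h2 := hle n' hn'
    omega
  · intro n hn
    rw [← pow2_mul_natCast]
    refine pow2_mono ?_
    have h1 := hle n hn
    push_cast [Nat.cast_sub h1]
    have h2 : y ≤ b * (⌈y / b⌉₊ : ℝ) := by
      rw [mul_comm, ← div_le_iff₀ hb]; exact Nat.le_ceil _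
    have h3 := mul_le_mul_of_nonneg_left h2 ha.le
    nlinarith

theorem tsum_pow2_neg_ne_top {a : ℝ} (ha : a < 0) : ∑' n : ℕ, pow2 (a * n) ≠ ∞ := by
  simp_rw [pow2_mul_natCast]
  rw [ENNReal.tsum_geometric]
  exact inv_one_sub_pow2_ne_top ha

end Geometric

/-! ### Almost sure convergence from summable moments. -/

section Convergence

variable {Ω : Type*} [MeasurableSpace Ω] {P : Measure Ω}

theorem ae_tendsto_zero_of_tsum_lintegral_ne_top {f : ℕ → Ω → ℝ≥0∞} (hf : ∀ n, Measurable (f n))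
    (h : ∑' n, ∫⁻ ω, f n ω ∂P ≠ ∞) : ∀ᵐ ω ∂P, Tendsto (fun n => f n ω) atTop (𝓝 0) := by
  rw [← lintegral_tsum fun n => (hf n).aemeasurable] at h
  filter_upwards [ae_lt_top (Measurable.tsum hf) h] with ω hω
  exact ENNReal.tendsto_atTop_zero_of_tsum_ne_top hω.ne

theorem ae_tendsto_zero_of_tsum_lintegral_sq_ne_top {f : ℕ → Ω → ℝ≥0∞}
    (hf : ∀ n, Measurable (f n)) (h : ∑' n, ∫⁻ ω, f n ω ^ 2 ∂P ≠ ∞) :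
    ∀ᵐ ω ∂P, Tendsto (fun n => f n ω) atTop (𝓝 0) := by
  filter_upwards [ae_tendsto_zero_of_tsum_lintegral_ne_top (fun n => (hf n).pow_const 2) h]
    with ω hω
  have h1 := hω.ennrpow_const (1 / 2 : ℝ)
  rw [ENNReal.zero_rpow_of_pos (by norm_num)] at h1
  refine h1.congr fun n => ?_
  rw [← ENNReal.rpow_natCast, ← ENNReal.rpow_mul]
  norm_num

end Convergence

/-! ### Separation of fine and coarse cells. -/

section Split

variable {d : ℕ}

/-- The contribution of the small cells, bounded through the number of points in the shells. -/
noncomputable def finePart (p s : ℝ) (μ : Measure (EuclideanSpace ℝ (Fin d)))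
    (x : ℕ → EuclideanSpace ℝ (Fin d)) (N : ℕ) : ℝ≥0∞ :=
  ∑' m : ℕ, ∑' j : ℕ, if (N : ℝ) < d * j + s * m then
    pow2 (p * ((m : ℝ) - j)) * totalMeasure μ x (2 ^ N) (shell ⁻¹' {m}) else 0

/-- The contribution of the large cells, bounded through the fluctuations. -/
noncomputable def coarsePart (p s : ℝ) (μ : Measure (EuclideanSpace ℝ (Fin d)))
    (x : ℕ → EuclideanSpace ℝ (Fin d)) (N : ℕ) : ℝ≥0∞ :=
  ∑' m : ℕ, ∑' j : ℕ, if (d * j + s * m : ℝ) ≤ N then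
    pow2 (p * ((m : ℝ) - j)) * cellGapMax μ x m j (2 ^ N) else 0

theorem tsum_cellGap_le (p s : ℝ) (μ : Measure (EuclideanSpace ℝ (Fin d)))
    [IsProbabilityMeasure μ] (x : ℕ → EuclideanSpace ℝ (Fin d)) {n N : ℕ} (h : n ≤ 2 ^ N) :
    ∑' m : ℕ, ∑' j : ℕ, pow2 (p * ((m : ℝ) - j)) * cellGap μ x m j n ≤
      finePart p s μ x N + coarsePart p s μ x N := by
  rw [finePart, coarsePart, ← ENNReal.tsum_add]
  refine ENNReal.tsum_le_tsum fun m => ?_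
  rw [← ENNReal.tsum_add]
  refine ENNReal.tsum_le_tsum fun j => ?_
  rcases lt_or_ge (N : ℝ) (d * j + s * m) with hN | hN
  · rw [if_pos hN, if_neg hN.not_ge, add_zero]
    gcongr
    exact cellGap_le_totalMeasure μ x m j h
  · rw [if_pos hN, if_neg hN.not_gt, zero_add]
    gcongr
    exact cellGap_le_cellGapMax μ x m j h

/-- Weighted Cauchy–Schwarz over the pairs (m, j). The exponents γ are free, and are chosen
separately in the two regimes so that both factors are controlled. -/
theorem sq_coarsePart_le (p s : ℝ) (μ : Measure (EuclideanSpace ℝ (Fin d)))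
    (x : ℕ → EuclideanSpace ℝ (Fin d)) (N : ℕ) (γ : ℕ → ℕ → ℝ) :
    coarsePart p s μ x N ^ 2 ≤
      (∑' m : ℕ, ∑' j : ℕ, if (d * j + s * m : ℝ) ≤ N then pow2 (γ m j) else 0) *
      ∑' m : ℕ, ∑' j : ℕ, if (d * j + s * m : ℝ) ≤ N then
        pow2 (2 * p * ((m : ℝ) - j) - γ m j) * cellGapMax μ x m j (2 ^ N) ^ 2 else 0 := by
  have h := sq_tsum_mul_le
    (fun i : ℕ × ℕ => if (d * i.2 + s * i.1 : ℝ) ≤ N then pow2 (γ i.1 i.2) else 0)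
    (fun i => pow2 (p * ((i.1 : ℝ) - i.2) - γ i.1 i.2) * cellGapMax μ x i.1 i.2 (2 ^ N))
  rw [ENNReal.tsum_prod', ENNReal.tsum_prod', ENNReal.tsum_prod'] at h
  refine le_trans (le_of_eq ?_) (h.trans (le_of_eq ?_))
  · rw [coarsePart]
    refine congrArg (· ^ 2) (tsum_congr fun m => tsum_congr fun j => ?_)
    split_ifs
    · rw [← mul_assoc, ← pow2_add]; congr 2; ring
    · simp
  · refine congrArg _ (tsum_congr fun m => tsum_congr fun j => ?_)
    split_ifs
    · rw [mul_pow, ← pow2_mul_natCast, ← mul_assoc, ← pow2_add]; congr 2; push_cast; ring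
    · simp

variable {Ω : Type*} [MeasurableSpace Ω] {P : Measure Ω} {μ : Measure (EuclideanSpace ℝ (Fin d))}
  {X : ℕ → Ω → EuclideanSpace ℝ (Fin d)}

theorem measurable_finePart (hX : ∀ k, Measurable (X k)) (p s : ℝ) (N : ℕ) :
    Measurable fun ω => finePart p s μ (fun k => X k ω) N := by
  refine Measurable.tsum fun m => Measurable.tsum fun j => ?_
  split_ifs
  · exact (measurable_totalMeasure hX _ (measurable_shell (measurableSet_singleton m))).const_mul _
  · exact measurable_const

theorem measurable_coarsePart (hX : ∀ k, Measurable (X k)) (p s : ℝ) (N : ℕ) :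
    Measurable fun ω => coarsePart p s μ (fun k => X k ω) N := by
  refine Measurable.tsum fun m => Measurable.tsum fun j => ?_
  split_ifs
  · exact (measurable_cellGapMax hX m j _).const_mul _
  · exact measurable_const

variable [IsProbabilityMeasure P]

theorem lintegral_finePart (hX : ∀ k, Measurable (X k)) (hlaw : ∀ k, P.map (X k) = μ) (p s : ℝ)
    (N : ℕ) : ∫⁻ ω, finePart p s μ (fun k => X k ω) N ∂P =
      ∑' m : ℕ, ∑' j : ℕ, if (N : ℝ) < d * j + s * m then
        pow2 (p * ((m : ℝ) - j)) * (2 * pow2 N * μ (shell ⁻¹' {m})) else 0 := by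
  have hF : ∀ m, MeasurableSet (shell (d := d) ⁻¹' {m}) := fun m =>
    measurable_shell (measurableSet_singleton m)
  have hm : ∀ m j : ℕ, Measurable fun ω => if (N : ℝ) < d * j + s * m then
      pow2 (p * ((m : ℝ) - j)) * totalMeasure μ (fun k => X k ω) (2 ^ N) (shell ⁻¹' {m})
      else 0 := by
    intro m j
    split_ifs
    · exact (measurable_totalMeasure hX _ (hF m)).const_mul _
    · exact measurable_const
  unfold finePart
  rw [lintegral_tsum fun m => (Measurable.tsum fun j => hm m j).aemeasurable]
  refine tsum_congr fun m => ?_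
  rw [lintegral_tsum fun j => (hm m j).aemeasurable]
  refine tsum_congr fun j => ?_
  split_ifs
  · rw [lintegral_const_mul' _ _ (pow2_ne_top _), lintegral_totalMeasure hX hlaw _ (hF m),
      pow2_natCast]
    push_cast
    rfl
  · simp

theorem lintegral_sq_coarsePart_le [IsProbabilityMeasure μ] (hX : ∀ k, Measurable (X k))
    (hind : iIndepFun X P) (hlaw : ∀ k, P.map (X k) = μ) (p s : ℝ) (N : ℕ) (γ : ℕ → ℕ → ℝ) :
    ∫⁻ ω, coarsePart p s μ (fun k => X k ω) N ^ 2 ∂P ≤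
      (∑' m : ℕ, ∑' j : ℕ, if (d * j + s * m : ℝ) ≤ N then pow2 (γ m j) else 0) *
      ∑' m : ℕ, ∑' j : ℕ, if (d * j + s * m : ℝ) ≤ N then
        4 * pow2 d * (pow2 (2 * p * ((m : ℝ) - j) - γ m j + d * j + N) * μ (shell ⁻¹' {m}))
        else 0 := by
  refine (lintegral_mono fun ω => sq_coarsePart_le p s μ (fun k => X k ω) N γ).trans ?_
  have hm : ∀ m j : ℕ, Measurable fun ω => if (d * j + s * m : ℝ) ≤ N then
        pow2 (2 * p * ((m : ℝ) - j) - γ m j) * cellGapMax μ (fun k => X k ω) m j (2 ^ N) ^ 2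
        else 0 := by
    intro m j
    split_ifs
    · exact ((measurable_cellGapMax hX m j _).pow_const 2).const_mul _
    · exact measurable_const
  rw [lintegral_const_mul _ (Measurable.tsum fun m => Measurable.tsum fun j =>
    hm m j)]
  gcongr
  rw [lintegral_tsum fun m => (Measurable.tsum fun j => hm m j).aemeasurable]
  refine ENNReal.tsum_le_tsum fun m => ?_
  rw [lintegral_tsum fun j => (hm m j).aemeasurable]
  refine ENNReal.tsum_le_tsum fun j => ?_
  split_ifs
  · rw [lintegral_const_mul' _ _ (pow2_ne_top _)]
    calc _ ≤ pow2 (2 * p * ((m : ℝ) - j) - γ m j) *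
          (pow2 (d * (j + 1)) * (4 * ((2 ^ N : ℕ) : ℝ≥0∞) * μ (shell ⁻¹' {m}))) := by
          gcongr
          exact lintegral_sq_cellGapMax_le hX hind hlaw m j _
      _ = _ := by
          have e : (d * (j + 1) : ℝ) = d + d * j := by ring
          rw [pow2_add _ (N : ℝ), pow2_add _ (d * j : ℝ), e, pow2_add, pow2_natCast N]
          push_cast
          ring
  · simp

end Split

/-! ### Size of the fine and coarse parts in the two regimes. -/

section Rates

theorem tsum_tsum_tsum_ne_top {T : ℕ → ℕ → ℕ → ℝ≥0∞} {c : ℕ → ℝ≥0∞} {κ : ℝ} {C : ℝ≥0∞}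
    (hc : ∑' m, c m ≠ ∞) (hκ : κ < 0) (hC : C ≠ ∞)
    (h : ∀ m j : ℕ, ∑' N, T N m j ≤ c m * (pow2 (κ * j) * C)) :
    ∑' N, ∑' m, ∑' j, T N m j ≠ ∞ := by
  have e : ∑' N, ∑' m, ∑' j, T N m j = ∑' m, ∑' j, ∑' N, T N m j := by
    rw [ENNReal.tsum_comm]
    exact tsum_congr fun m => ENNReal.tsum_comm
  rw [e]
  refine ne_top_of_le_ne_top ?_
    (ENNReal.tsum_le_tsum fun m => ENNReal.tsum_le_tsum fun j => h m j)
  simp_rw [ENNReal.tsum_mul_left, ENNReal.tsum_mul_right]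
  exact ENNReal.mul_ne_top hc (ENNReal.mul_ne_top (tsum_pow2_neg_ne_top hκ) hC)

variable {d : ℕ} {Ω : Type*} [MeasurableSpace Ω] {P : Measure Ω}
  {μ : Measure (EuclideanSpace ℝ (Fin d))} {X : ℕ → Ω → EuclideanSpace ℝ (Fin d)} {p r : ℝ}

/-- For fixed m, the series over dj > N - rpm is of order at most 2^(pm-(p/d)(N-rpm)), and p +
rp·p/d ≤ rp because rp/d ≤ r - 1. The bound is pathwise. -/
theorem exists_finePart_le (hd : 0 < d) (hp0 : 0 < p) (hr1 : 1 < r)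
    (hp : p < (d : ℝ) * (r - 1) / r) :
    ∃ C ≠ ∞, ∀ (x : ℕ → EuclideanSpace ℝ (Fin d)) (N : ℕ), finePart p (r * p) μ x N ≤
      C * pow2 (-(p / d * N)) * ∫⁻ y, pow2 (r * p * shell y) ∂(totalMeasure μ x (2 ^ N)) := by
  have hr0 : 0 < r := by linarith
  have hd0 : (0 : ℝ) < d := by exact_mod_cast hd
  obtain ⟨q, hq⟩ : ∃ q, q = p / d := ⟨_, rfl⟩
  have hpq : p = q * d := by rw [hq]; field_simp
  have hq0 : 0 < q := by rw [hq]; positivity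
  have hq1 : q < 1 - 1 / r := by
    rw [hq, div_lt_iff₀ hd0]
    have : (d : ℝ) * (r - 1) / r = (1 - 1 / r) * d := by field_simp
    linarith
  obtain ⟨C, hC, hCle⟩ := exists_tsum_pow2_above_le hq0 hd0
  refine ⟨C, hC, fun x N => ?_⟩
  rw [lintegral_comp_shell _ (fun m => pow2 (r * p * m)), ← ENNReal.tsum_mul_left, finePart]
  refine ENNReal.tsum_le_tsum fun m => ?_
  rw [show C * pow2 (-(p / d * N)) *
      (pow2 (r * p * m) * totalMeasure μ x (2 ^ N) (shell ⁻¹' {m})) =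
      pow2 (-(p / d * N)) * pow2 (r * p * m) * totalMeasure μ x (2 ^ N) (shell ⁻¹' {m}) * C by ring]
  refine le_trans ?_ (mul_le_mul_right (hCle (N - r * p * m)) _)
  rw [← ENNReal.tsum_mul_left]
  refine ENNReal.tsum_le_tsum fun j => ?_
  split_ifs with h1 h2
  · have e : pow2 (p * ((m : ℝ) - j)) ≤ pow2 (-(p / d * N)) * pow2 (r * p * m) *
        pow2 (q * ((N - r * p * m) - d * j)) := by
      simp only [← pow2_add]
      refine pow2_mono ?_
      rw [← hq, hpq]
      have h3 : r * q ≤ r - 1 := by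
        have := mul_le_mul_of_nonneg_left hq1.le hr0.le
        have h4 : r * (1 - 1 / r) = r - 1 := by field_simp
        linarith
      have h5 : 0 ≤ q * d * m := by positivity
      nlinarith
    calc _ ≤ _ := mul_le_mul_left e _
      _ = _ := by ring
  · exact absurd (by linarith) h2
  · simp
  · simp

variable [IsProbabilityMeasure P]

theorem tsum_lintegral_finePart_ne_top (hX : ∀ k, Measurable (X k))
    (hlaw : ∀ k, P.map (X k) = μ) (hr1 : 1 < r) (hp : (d : ℝ) * (r - 1) / r < p)
    (hM : ∑' m : ℕ, pow2 (r * p * m) * μ (shell ⁻¹' {m}) ≠ ∞) :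
    ∑' N : ℕ, ∫⁻ ω, pow2 (-(N / r)) * finePart p (r * p) μ (fun k => X k ω) N ∂P ≠ ∞ := by
  have hr0 : 0 < r := by linarith
  have ha : 0 < 1 - 1 / r := by
    have : 1 / r < 1 := (div_lt_one hr0).2 hr1
    linarith
  have hκ : d * (1 - 1 / r) - p < 0 := by
    have : (d : ℝ) * (r - 1) / r = d * (1 - 1 / r) := by field_simp
    linarith
  obtain ⟨C, hC, hCle⟩ := exists_tsum_pow2_below_le ha one_pos
  simp_rw [lintegral_const_mul' _ _ (pow2_ne_top _), lintegral_finePart hX hlaw,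
    ← ENNReal.tsum_mul_left]
  refine tsum_tsum_tsum_ne_top (c := fun m => 2 * (pow2 (r * p * m) * μ (shell ⁻¹' {m})))
    (by rw [ENNReal.tsum_mul_left]; exact ENNReal.mul_ne_top ENNReal.ofNat_ne_top hM) hκ hC
    fun m j => ?_
  refine le_trans ?_ (mul_le_mul_right (mul_le_mul_right (hCle (d * j + r * p * m)) _) _)
  simp_rw [← ENNReal.tsum_mul_left]
  refine ENNReal.tsum_le_tsum fun N => ?_
  split_ifs with h1 h2
  · have e : pow2 (-(N / r)) * pow2 (p * ((m : ℝ) - j)) * pow2 N =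
        pow2 (r * p * m) * pow2 ((d * (1 - 1 / r) - p) * j) *
          pow2 ((1 - 1 / r) * (1 * N - (d * j + r * p * m))) := by
      simp only [← pow2_add]; congr 1; field_simp; ring
    calc _ = 2 * μ (shell ⁻¹' {m}) *
          (pow2 (-(N / r)) * pow2 (p * ((m : ℝ) - j)) * pow2 N) := by ring
      _ = 2 * μ (shell ⁻¹' {m}) * (pow2 (r * p * m) * pow2 ((d * (1 - 1 / r) - p) * j) *
          pow2 ((1 - 1 / r) * (1 * N - (d * j + r * p * m)))) := by rw [e]
      _ ≤ _ := le_of_eq (by ring)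
  · exact absurd (by linarith) h2
  · simp
  · simp

variable [IsProbabilityMeasure μ]

theorem tsum_lintegral_sq_coarsePart_ne_top (hX : ∀ k, Measurable (X k)) (hind : iIndepFun X P)
    (hlaw : ∀ k, P.map (X k) = μ) (hp0 : 0 < p) (hr1 : 1 < r) (hr2 : r < 2)
    (hp : (d : ℝ) * (r - 1) / r < p)
    (hM : ∑' m : ℕ, pow2 (r * p * m) * μ (shell ⁻¹' {m}) ≠ ∞) :
    ∑' N : ℕ, ∫⁻ ω, (pow2 (-(N / r)) * coarsePart p (r * p) μ (fun k => X k ω) N) ^ 2 ∂P ≠ ∞ := by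
  have hr0 : 0 < r := by linarith
  have hs : 0 < r * p := mul_pos hr0 hp0
  -- A small loss δ in the exponents: the second condition keeps the series in N convergent (this
  -- needs r < 2), the third the series in j (this needs p > d(r-1)/r).
  obtain ⟨δ, hδ0, hδ1, hδ2⟩ : ∃ δ : ℝ, 0 < δ ∧ 0 < 2 / r - 1 - δ ∧
      -2 * p + 2 * d * (1 - 1 / r) + δ * (1 + d) < 0 := by
    have h1 : 0 < 2 / r - 1 := by rw [sub_pos, lt_div_iff₀ hr0]; linarith
    have h2 : 0 < (2 * p - 2 * d * (1 - 1 / r)) / (1 + d) := by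
      have : (d : ℝ) * (r - 1) / r = d * (1 - 1 / r) := by field_simp
      refine div_pos ?_ (by positivity)
      linarith
    obtain ⟨δ, h3, h4⟩ := exists_between (lt_min h1 h2)
    have h5 := h4.trans_le (min_le_left _ _)
    have h6 := h4.trans_le (min_le_right _ _)
    rw [lt_div_iff₀ (by positivity)] at h6
    exact ⟨δ, h3, by linarith, by linarith⟩
  obtain ⟨C₁, hC₁, hC₁le⟩ := exists_tsum_pow2_below_le hδ0 hs
  obtain ⟨C, hC, hCle⟩ := exists_tsum_pow2_above_le hδ1 one_pos
  set G : ℝ≥0∞ := C₁ * ∑' j : ℕ, pow2 (-δ * j) with hG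
  have hGtop : G ≠ ∞ := ENNReal.mul_ne_top hC₁ (tsum_pow2_neg_ne_top (by linarith))
  -- These weights sum to a constant independent of N: in m they decay away from the bound rpm = N,
  -- in j away from 0.
  set γ : ℕ → ℕ → ℕ → ℝ := fun N m j => δ * (r * p * m - N) + -δ * j with hγ
  have hg : ∀ N : ℕ, (∑' m : ℕ, ∑' j : ℕ,
      if (d * j + r * p * m : ℝ) ≤ N then pow2 (γ N m j) else 0) ≤ G := by
    intro N
    refine le_trans ?_ (mul_le_mul_left (hC₁le N) _)
    rw [← ENNReal.tsum_mul_right]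
    refine ENNReal.tsum_le_tsum fun m => ?_
    rw [← ENNReal.tsum_mul_left]
    refine ENNReal.tsum_le_tsum fun j => ?_
    split_ifs with h1 h2
    · rw [← pow2_add]
    · exact absurd (le_trans (le_add_of_nonneg_left (by positivity)) h1) h2
    · simp
    · simp
  have hK : 4 * pow2 d ≠ ∞ := ENNReal.mul_ne_top ENNReal.ofNat_ne_top (pow2_ne_top _)
  have hle : ∀ N : ℕ, ∫⁻ ω, (pow2 (-(N / r)) * coarsePart p (r * p) μ (fun k => X k ω) N) ^ 2 ∂P ≤
      G * ∑' m : ℕ, ∑' j : ℕ, pow2 (-(N / r) * 2) * if (d * j + r * p * m : ℝ) ≤ N then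
        4 * pow2 d * (pow2 (2 * p * ((m : ℝ) - j) - γ N m j + d * j + N) * μ (shell ⁻¹' {m}))
        else 0 := by
    intro N
    have e : ∀ ω, (pow2 (-(N / r)) * coarsePart p (r * p) μ (fun k => X k ω) N) ^ 2 =
        pow2 (-(N / r) * 2) * coarsePart p (r * p) μ (fun k => X k ω) N ^ 2 := by
      intro ω
      have := pow2_mul_natCast (-(N / r)) 2
      push_cast at this
      rw [mul_pow, this]
    simp_rw [e, ENNReal.tsum_mul_left]
    rw [lintegral_const_mul' _ _ (pow2_ne_top _), mul_left_comm]
    gcongr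
    refine (lintegral_sq_coarsePart_le hX hind hlaw p (r * p) N (γ N)).trans ?_
    gcongr
    exact hg N
  refine ne_top_of_le_ne_top ?_ (ENNReal.tsum_le_tsum hle)
  rw [ENNReal.tsum_mul_left]
  refine ENNReal.mul_ne_top hGtop ?_
  refine tsum_tsum_tsum_ne_top
    (c := fun m => 4 * pow2 d * (pow2 (r * p * m) * μ (shell ⁻¹' {m})))
    (by rw [ENNReal.tsum_mul_left]; exact ENNReal.mul_ne_top hK hM) hδ2 hC fun m j => ?_
  refine le_trans ?_ (mul_le_mul_right (mul_le_mul_right (hCle (d * j + r * p * m)) _) _)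
  simp_rw [← ENNReal.tsum_mul_left]
  refine ENNReal.tsum_le_tsum fun N => ?_
  split_ifs with h1 h2
  · have e : pow2 (-(N / r) * 2) * pow2 (2 * p * ((m : ℝ) - j) - γ N m j + d * j + N) =
        pow2 (r * p * m) * pow2 ((-2 * p + 2 * d * (1 - 1 / r) + δ * (1 + d)) * j) *
          pow2 ((2 / r - 1 - δ) * ((d * j + r * p * m) - 1 * N)) := by
      simp only [← pow2_add, hγ]; congr 1; field_simp; ring
    calc _ = 4 * pow2 d * μ (shell ⁻¹' {m}) * (pow2 (-(N / r) * 2) *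
          pow2 (2 * p * ((m : ℝ) - j) - γ N m j + d * j + N)) := by ring
      _ ≤ _ := by rw [e]; exact le_of_eq (by ring)
  · exact absurd (by linarith) h2
  · simp
  · simp

theorem exists_lintegral_sq_coarsePart_le (hX : ∀ k, Measurable (X k)) (hind : iIndepFun X P)
    (hlaw : ∀ k, P.map (X k) = μ) (hd : 0 < d) (hp0 : 0 < p) (hr1 : 1 < r) (hr2 : r < 2)
    (hp : p < (d : ℝ) * (r - 1) / r)
    (hM : ∑' m : ℕ, pow2 (r * p * m) * μ (shell ⁻¹' {m}) ≠ ∞) :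
    ∃ C ≠ ∞, ∀ N : ℕ, ∫⁻ ω, coarsePart p (r * p) μ (fun k => X k ω) N ^ 2 ∂P ≤
      C * pow2 (2 * ((1 - p / d) * N)) := by
  have hr0 : 0 < r := by linarith
  have hd0 : (0 : ℝ) < d := by exact_mod_cast hd
  obtain ⟨q, hq⟩ : ∃ q, q = p / d := ⟨_, rfl⟩
  have hpq : p = q * d := by rw [hq]; field_simp
  have hq0 : 0 < q := by rw [hq]; positivity
  have hq1 : q < 1 - 1 / r := by
    rw [hq, div_lt_iff₀ hd0]
    have : (d : ℝ) * (r - 1) / r = (1 - 1 / r) * d := by field_simp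
    linarith
  have hr3 : 1 / 2 < 1 / r := one_div_lt_one_div_of_lt hr0 hr2
  -- The second moments grow like 2^((d-2p)j) = 2^(2θdj); half of this growth goes into the weights.
  -- Positivity of θ follows from q < 1 - 1/r < 1/2.
  obtain ⟨θ, hθ⟩ : ∃ θ, θ = (1 - 2 * q) / 2 := ⟨_, rfl⟩
  have hθ0 : 0 < θ := by rw [hθ]; linarith
  -- The value for which the remaining exponent in m is exactly rp, the one controlled by the
  -- moment; it is positive exactly because q < 1 - 1/r.
  obtain ⟨δ, hδ⟩ : ∃ δ, δ = 2 * r * p * (1 - 1 / r - q) := ⟨_, rfl⟩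
  have hδ0 : 0 < δ := by
    rw [hδ]; exact mul_pos (by positivity) (by linarith)
  obtain ⟨C, hC, hCle⟩ := exists_tsum_pow2_below_le hθ0 hd0
  set G : ℝ≥0∞ := (∑' m : ℕ, pow2 (-δ * m)) * C with hG
  have hGtop : G ≠ ∞ := ENNReal.mul_ne_top (tsum_pow2_neg_ne_top (by linarith)) hC
  set M : ℝ≥0∞ := ∑' m : ℕ, pow2 (r * p * m) * μ (shell ⁻¹' {m})
  have hK : 4 * pow2 d ≠ ∞ := ENNReal.mul_ne_top ENNReal.ofNat_ne_top (pow2_ne_top _)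
  refine ⟨G * (4 * pow2 d * (M * C)), by finiteness, fun N => ?_⟩
  refine (lintegral_sq_coarsePart_le hX hind hlaw p (r * p) N
    (fun m j => -δ * m + θ * (d * j - (N - r * p * m)))).trans ?_
  rw [mul_assoc]
  refine mul_le_mul' ?_ ?_
  · rw [hG, ← ENNReal.tsum_mul_right]
    refine ENNReal.tsum_le_tsum fun m => ?_
    refine le_trans ?_ (mul_le_mul_right (hCle (N - r * p * m)) _)
    rw [← ENNReal.tsum_mul_left]
    refine ENNReal.tsum_le_tsum fun j => ?_
    split_ifs with h1 h2
    · rw [← pow2_add]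
    · exact absurd (by linarith) h2
    · simp
    · simp
  · rw [show 4 * pow2 d * (M * C) * pow2 (2 * ((1 - p / d) * N)) =
      M * (4 * pow2 d * pow2 (2 * ((1 - p / d) * N)) * C) by ring, ← ENNReal.tsum_mul_right]
    refine ENNReal.tsum_le_tsum fun m => ?_
    refine le_trans ?_ (mul_le_mul_right (mul_le_mul_right (hCle (N - r * p * m)) _) _)
    simp_rw [← ENNReal.tsum_mul_left]
    refine ENNReal.tsum_le_tsum fun j => ?_
    split_ifs with h1 h2
    · have e : pow2 (2 * p * ((m : ℝ) - j) - (-δ * m + θ * (d * j - (N - r * p * m))) +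
          d * j + N) = pow2 (r * p * m) * pow2 (2 * ((1 - p / d) * N)) *
            pow2 (θ * (d * j - (N - r * p * m))) := by
        simp only [← pow2_add]
        congr 1
        rw [← hq, hδ, hθ, hpq]
        field_simp
        ring
      rw [e]
      exact le_of_eq (by ring)
    · exact absurd (by linarith) h2
    · simp
    · simp

end Rates

/-! ### Strong law, passage to all n, and the two limits. -/

section Main

variable {d : ℕ} {Ω : Type*} [MeasurableSpace Ω] {P : Measure Ω}
  {μ : Measure (EuclideanSpace ℝ (Fin d))}
  {X : ℕ → Ω → EuclideanSpace ℝ (Fin d)} {p r : ℝ}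

theorem ae_exists_lintegral_totalMeasure_le (hX : ∀ k, Measurable (X k)) (hind : iIndepFun X P)
    (hlaw : ∀ k, P.map (X k) = μ) {s : ℝ} (hM : ∫⁻ x, pow2 (s * shell x) ∂μ ≠ ∞) :
    ∀ᵐ ω ∂P, ∃ B ≠ ∞, ∀ᶠ N : ℕ in atTop,
      ∫⁻ y, pow2 (s * shell y) ∂(totalMeasure μ (fun k => X k ω) (2 ^ N)) ≤ B * pow2 N := by
  have hpm : Measurable fun x : EuclideanSpace ℝ (Fin d) => pow2 (s * shell x) :=
    (measurable_of_countable fun m : ℕ => pow2 (s * m)).comp measurable_shell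
  set f : EuclideanSpace ℝ (Fin d) → ℝ := fun x => 2 ^ (s * shell x) with hf
  have hfm : Measurable f :=
    (measurable_from_top (f := fun m : ℕ => (2 : ℝ) ^ (s * m))).comp measurable_shell
  have hf0 : ∀ x, 0 ≤ f x := fun x => by positivity
  have hfi : Integrable f μ := by
    refine ⟨hfm.aestronglyMeasurable, ?_⟩
    rw [hasFiniteIntegral_iff_ofReal (Eventually.of_forall hf0)]
    simp_rw [hf, ← pow2_eq_ofReal]
    exact hM.lt_top
  have hint : Integrable (fun ω => f (X 0 ω)) P := by
    rw [← hlaw 0] at hfi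
    exact hfi.comp_measurable (hX 0)
  have hslln := strong_law_ae_real (μ := P) (fun k ω => f (X k ω)) hint
    (fun i j hij => (hind.indepFun hij).comp hfm hfm)
    (fun i => (⟨(hX i).aemeasurable, (hX 0).aemeasurable, by rw [hlaw, hlaw]⟩ :
      IdentDistrib (X i) (X 0) P P).comp hfm)
  filter_upwards [hslln] with ω hω
  obtain ⟨K, hK⟩ := exists_gt (∫ ω, f (X 0 ω) ∂P)
  refine ⟨ENNReal.ofReal K + ∫⁻ x, pow2 (s * shell x) ∂μ,
    ENNReal.add_ne_top.2 ⟨ENNReal.ofReal_ne_top, hM⟩, ?_⟩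
  have h1 := (hω.eventually (gt_mem_nhds hK))
  have h2 : Tendsto (fun N : ℕ => 2 ^ N) atTop atTop :=
    tendsto_pow_atTop_atTop_of_one_lt (one_lt_two : 1 < 2)
  filter_upwards [h2.eventually h1] with N hN
  rw [totalMeasure, lintegral_add_measure, lintegral_finsetSum_measure, lintegral_smul_measure,
    add_mul]
  refine add_le_add ?_ (le_of_eq ?_)
  · simp_rw [lintegral_dirac' _ hpm, pow2_eq_ofReal]
    rw [← ENNReal.ofReal_sum_of_nonneg fun l _ => hf0 (X l ω), ← ENNReal.ofReal_mul']
    · refine ENNReal.ofReal_le_ofReal ?_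
      rw [div_lt_iff₀ (by positivity)] at hN
      rw [Real.rpow_natCast]
      exact_mod_cast hN.le
    · positivity
  · rw [pow2_natCast, mul_comm]; simp

/-- With N = `Nat.log 2 n + 1` one has n ≤ 2^N, and both parts at N dominate all such n; hence
convergence along N suffices, with no monotonicity of the cost in n. -/
theorem tendsto_mul_wassersteinPow [IsProbabilityMeasure μ] (hp : 0 < p) (s : ℝ)
    (x : ℕ → EuclideanSpace ℝ (Fin d)) (a : ℕ → ℝ) (β : ℕ → ℝ≥0∞)
    (hβ : Tendsto (fun N => β N * (finePart p s μ x N + coarsePart p s μ x N)) atTop (𝓝 0))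
    {K : ℝ≥0∞} (hK : K ≠ ∞)
    (ha : ∀ᶠ n : ℕ in atTop, ENNReal.ofReal (a n) ≤ K * β (Nat.log 2 n + 1) * n) :
    Tendsto (fun n : ℕ => ENNReal.ofReal (a n) * wassersteinPow p (empiricalMeasure x n) μ)
      atTop (𝓝 0) := by
  have hC : ((2 : ℝ≥0∞) * d) ^ p ≠ ∞ := ENNReal.rpow_ne_top_of_nonneg hp.le (by finiteness)
  have hlog : Tendsto (fun n => Nat.log 2 n + 1) atTop atTop :=
    tendsto_atTop.2 fun b => by
      filter_upwards [eventually_ge_atTop (2 ^ b)] with n hn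
      exact (Nat.le_log_of_pow_le one_lt_two hn).trans (Nat.le_succ _)
  have h1 := ENNReal.Tendsto.const_mul (a := K * (2 * d) ^ p) (hβ.comp hlog)
    (Or.inr (ENNReal.mul_ne_top hK hC))
  rw [mul_zero] at h1
  refine tendsto_of_tendsto_of_tendsto_of_le_of_le' tendsto_const_nhds h1
    (Eventually.of_forall fun n => zero_le) ?_
  filter_upwards [ha, eventually_ne_atTop 0] with n hn hn0
  have h2 : n ≤ 2 ^ (Nat.log 2 n + 1) := (Nat.lt_pow_succ_log_self one_lt_two n).le
  calc _ ≤ K * β (Nat.log 2 n + 1) * n * wassersteinPow p (empiricalMeasure x n) μ :=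
        mul_le_mul_left hn _
    _ = K * β (Nat.log 2 n + 1) * (n * wassersteinPow p (empiricalMeasure x n) μ) := by ring
    _ ≤ K * β (Nat.log 2 n + 1) * ((2 * d) ^ p * (finePart p s μ x (Nat.log 2 n + 1) +
          coarsePart p s μ x (Nat.log 2 n + 1))) := by
        refine mul_le_mul_right ?_ _
        exact (mul_wassersteinPow_empiricalMeasure_le hp μ x hn0).trans
          (mul_le_mul_right (tsum_cellGap_le p s μ x h2) _)
    _ = _ := by simp only [Function.comp]; ring

theorem rpow_neg_le_two_mul {t : ℝ} (ht0 : 0 ≤ t) (ht1 : t ≤ 1) {n : ℕ} (hn : n ≠ 0) :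
    (n : ℝ) ^ (-t) ≤ 2 * 2 ^ (-(t * (Nat.log 2 n + 1 : ℕ))) := by
  have h1 : (2 : ℝ) ^ (Nat.log 2 n) ≤ n := by exact_mod_cast Nat.pow_log_le_self 2 hn
  calc (n : ℝ) ^ (-t) ≤ ((2 : ℝ) ^ (Nat.log 2 n)) ^ (-t) :=
        Real.rpow_le_rpow_of_nonpos (by positivity) h1 (by linarith)
    _ = 2 ^ (-(t * Nat.log 2 n)) := by
        rw [← Real.rpow_natCast, ← Real.rpow_mul two_pos.le]; congr 1; ring
    _ ≤ 2 ^ (1 + -(t * (Nat.log 2 n + 1 : ℕ))) := by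
        refine Real.rpow_le_rpow_of_exponent_le one_le_two ?_
        push_cast; linarith
    _ = _ := by rw [Real.rpow_add two_pos, Real.rpow_one]

theorem log_two_log_add_one_le {n : ℕ} (hn : 2 ≤ n) :
    ((Nat.log 2 n + 1 : ℕ) : ℝ) / 4 ≤ Real.log n := by
  have h1 : (2 : ℝ) ^ (Nat.log 2 n) ≤ n := by exact_mod_cast Nat.pow_log_le_self 2 (by omega)
  have h2 := Real.log_le_log (by positivity) h1
  rw [Real.log_pow] at h2
  have h3 : (1 : ℝ) ≤ Nat.log 2 n := by
    exact_mod_cast Nat.log_pos one_lt_two hn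
  have h4 := Real.log_two_gt_d9
  push_cast
  nlinarith

variable [IsProbabilityMeasure P]

theorem ae_tendsto_of_lt [IsProbabilityMeasure μ] (hX : ∀ k, Measurable (X k))
    (hind : iIndepFun X P) (hlaw : ∀ k, P.map (X k) = μ) (hp0 : 0 < p) (hr1 : 1 < r) (hr2 : r < 2)
    (hp : (d : ℝ) * (r - 1) / r < p) (hM : ∫⁻ x, pow2 (r * p * shell x) ∂μ ≠ ∞) :
    ∀ᵐ ω ∂P, Tendsto (fun n : ℕ => ENNReal.ofReal ((n : ℝ) ^ ((r - 1) / r)) *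
      wassersteinPow p (empiricalMeasure (fun k => X k ω) n) μ) atTop (𝓝 0) := by
  have hr0 : 0 < r := by linarith
  rw [lintegral_comp_shell μ (fun m => pow2 (r * p * m))] at hM
  filter_upwards [ae_tendsto_zero_of_tsum_lintegral_ne_top
      (fun N => (measurable_finePart hX p (r * p) N).const_mul _)
      (tsum_lintegral_finePart_ne_top hX hlaw hr1 hp hM),
    ae_tendsto_zero_of_tsum_lintegral_sq_ne_top
      (fun N => (measurable_coarsePart hX p (r * p) N).const_mul _)
      (tsum_lintegral_sq_coarsePart_ne_top hX hind hlaw hp0 hr1 hr2 hp hM)] with ω h1 h2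
  refine tendsto_mul_wassersteinPow hp0 (r * p) _ _ (fun N => pow2 (-(N / r)))
    (by simpa [mul_add] using h1.add h2) (K := 2) ENNReal.ofNat_ne_top ?_
  filter_upwards [eventually_ne_atTop 0] with n hn
  have hn0 : (0 : ℝ) < n := by positivity
  have e : (n : ℝ) ^ ((r - 1) / r) = (n : ℝ) ^ (-(1 / r)) * n := by
    rw [← Real.rpow_add_one hn0.ne']; congr 1; field_simp; ring
  have h3 := rpow_neg_le_two_mul (t := 1 / r) (by positivity) ((div_le_one hr0).2 hr1.le) hn
  rw [e, ENNReal.ofReal_mul (by positivity), ENNReal.ofReal_natCast, pow2_eq_ofReal]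
  gcongr
  refine (ENNReal.ofReal_le_ofReal h3).trans (le_of_eq ?_)
  rw [ENNReal.ofReal_mul two_pos.le, ENNReal.ofReal_ofNat]
  congr 3
  ring

theorem ae_tendsto_of_gt [IsProbabilityMeasure μ] (hX : ∀ k, Measurable (X k))
    (hind : iIndepFun X P) (hlaw : ∀ k, P.map (X k) = μ) (hd : 0 < d) (hp0 : 0 < p) (hr1 : 1 < r)
    (hr2 : r < 2) (hp : p < (d : ℝ) * (r - 1) / r)
    (hM : ∫⁻ x, pow2 (r * p * shell x) ∂μ ≠ ∞) :
    ∀ᵐ ω ∂P, Tendsto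
      (fun n : ℕ => ENNReal.ofReal ((n : ℝ) ^ (p / (d : ℝ)) / Real.log (n : ℝ) ^ (1 / r)) *
      wassersteinPow p (empiricalMeasure (fun k => X k ω) n) μ) atTop (𝓝 0) := by
  have hr0 : 0 < r := by linarith
  have hd0 : (0 : ℝ) < d := by exact_mod_cast hd
  have hq0 : 0 < p / d := by positivity
  have hq1 : p / d < 1 := by
    have h1 : (r - 1) / r < 1 := (div_lt_one hr0).2 (by linarith)
    rw [div_lt_one hd0]
    calc p < (d : ℝ) * (r - 1) / r := hp
      _ = d * ((r - 1) / r) := by ring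
      _ ≤ d * 1 := by gcongr
      _ = d := mul_one _
  set t : ℝ := 1 - p / d with ht
  -- Stands for (log n)^(-1/r), as N is comparable with log n. At N = 0 the value is 0 by
  -- convention; the blocks used have N ≥ 1.
  set u : ℕ → ℝ := fun N => (N : ℝ) ^ (-(1 / r)) with hu
  have hu0 : ∀ N, 0 ≤ u N := fun N => by positivity
  set β : ℕ → ℝ≥0∞ := fun N => ENNReal.ofReal (u N) * pow2 (-(t * N)) with hβ
  have hcoarse : ∑' N : ℕ, ∫⁻ ω, (β N * coarsePart p (r * p) μ (fun k => X k ω) N) ^ 2 ∂P ≠ ∞ := by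
    obtain ⟨C, hC, hCle⟩ := exists_lintegral_sq_coarsePart_le hX hind hlaw hd hp0 hr1 hr2 hp
      (by rwa [lintegral_comp_shell μ (fun m => pow2 (r * p * m))] at hM)
    have hterm : ∀ N : ℕ, ∫⁻ ω, (β N * coarsePart p (r * p) μ (fun k => X k ω) N) ^ 2 ∂P ≤
        C * ENNReal.ofReal ((N : ℝ) ^ (-(2 / r))) := by
      intro N
      simp_rw [mul_pow]
      have hβN : β N ^ 2 ≠ ∞ := ENNReal.pow_ne_top
        (ENNReal.mul_ne_top ENNReal.ofReal_ne_top (pow2_ne_top _))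
      rw [lintegral_const_mul' _ _ hβN]
      refine (mul_le_mul_right (hCle N) _).trans (le_of_eq ?_)
      have e1 : β N ^ 2 = ENNReal.ofReal ((N : ℝ) ^ (-(2 / r))) * pow2 (-(t * N) * 2) := by
        have := pow2_mul_natCast (-(t * N)) 2
        push_cast at this
        rw [this, hβ, mul_pow, ← ENNReal.ofReal_pow (hu0 N), hu]
        congr 2
        rw [← Real.rpow_natCast, ← Real.rpow_mul (by positivity)]
        congr 1; push_cast; ring
      have e2 : pow2 (-(t * N) * 2) * pow2 (2 * (t * N)) = 1 := by
        rw [← pow2_add, ← pow2_zero]; congr 1; ring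
      calc _ = C * ENNReal.ofReal ((N : ℝ) ^ (-(2 / r))) *
            (pow2 (-(t * N) * 2) * pow2 (2 * (t * N))) := by rw [e1]; ring
        _ = _ := by rw [e2, mul_one]
    refine ne_top_of_le_ne_top ?_ (ENNReal.tsum_le_tsum hterm)
    rw [ENNReal.tsum_mul_left]
    refine ENNReal.mul_ne_top hC ?_
    have hs : Summable fun N : ℕ => (N : ℝ) ^ (-(2 / r)) := by
      rw [Real.summable_nat_rpow, neg_lt_neg_iff, lt_div_iff₀ hr0]; linarith
    rw [← ENNReal.ofReal_tsum_of_nonneg (fun N => by positivity) hs]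
    exact ENNReal.ofReal_ne_top
  obtain ⟨C, hC, hCle⟩ := exists_finePart_le (μ := μ) hd hp0 hr1 hp
  have hu_lim : Tendsto (fun N => ENNReal.ofReal (u N)) atTop (𝓝 0) := by
    have := (tendsto_rpow_neg_atTop (y := 1 / r) (by positivity)).comp tendsto_natCast_atTop_atTop
    simpa [hu, Function.comp_def] using ENNReal.tendsto_ofReal this
  filter_upwards [ae_exists_lintegral_totalMeasure_le hX hind hlaw hM,
    ae_tendsto_zero_of_tsum_lintegral_sq_ne_top
      (fun N => (measurable_coarsePart hX p (r * p) N).const_mul _) hcoarse] with ω h1 h2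
  obtain ⟨B, hB, hBle⟩ := h1
  have h3 : Tendsto (fun N => β N * finePart p (r * p) μ (fun k => X k ω) N) atTop (𝓝 0) := by
    have h4 := ENNReal.Tendsto.const_mul (a := C * B) hu_lim (Or.inr (ENNReal.mul_ne_top hC hB))
    rw [mul_zero] at h4
    refine tendsto_of_tendsto_of_tendsto_of_le_of_le' tendsto_const_nhds h4
      (Eventually.of_forall fun n => zero_le) ?_
    filter_upwards [hBle] with N hN
    have e : pow2 (-(t * N)) * pow2 (-(p / d * N)) * pow2 N = 1 := by
      rw [← pow2_add, ← pow2_add, ← pow2_zero]; congr 1; rw [ht]; ring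
    calc β N * finePart p (r * p) μ (fun k => X k ω) N
        ≤ β N * (C * pow2 (-(p / d * N)) * (B * pow2 N)) := by
          gcongr
          exact (hCle _ N).trans (mul_le_mul_right hN _)
      _ = C * B * ENNReal.ofReal (u N) *
          (pow2 (-(t * N)) * pow2 (-(p / d * N)) * pow2 N) := by rw [hβ]; ring
      _ = _ := by rw [e, mul_one]
  -- In K, the 2 comes from comparing n^(-t) with 2^(-tN), and the 4 from log n ≥ N/4 together with
  -- 4^(1/r) ≤ 4.
  refine tendsto_mul_wassersteinPow hp0 (r * p) _ _ β
    (by simpa [mul_add] using h3.add h2) (K := 2 * 4) (by finiteness) ?_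
  filter_upwards [eventually_ge_atTop 2] with n hn
  have hn0 : (0 : ℝ) < n := by positivity
  set N : ℕ := Nat.log 2 n + 1 with hN
  have hNpos : (0 : ℝ) < N := by rw [hN]; positivity
  have e : (n : ℝ) ^ (p / (d : ℝ)) = (n : ℝ) ^ (-t) * n := by
    rw [← Real.rpow_add_one hn0.ne']; congr 1; rw [ht]; ring
  have h5 := rpow_neg_le_two_mul (t := t) (by rw [ht]; linarith) (by rw [ht]; linarith)
    (n := n) (by omega)
  have h6 : (Real.log n ^ (1 / r))⁻¹ ≤ 4 * u N := by
    have h7 : 0 < (N : ℝ) / 4 := by positivity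
    have h8 := Real.rpow_le_rpow_of_nonpos h7 (log_two_log_add_one_le hn)
      (z := -(1 / r)) (by have : 0 < 1 / r := by positivity
                          linarith)
    have h9 : 0 ≤ Real.log n := h7.le.trans (log_two_log_add_one_le hn)
    rw [← Real.rpow_neg h9]
    refine h8.trans ?_
    rw [Real.div_rpow hNpos.le (by norm_num), Real.rpow_neg (by norm_num : (0 : ℝ) ≤ 4),
      div_inv_eq_mul, mul_comm]
    refine mul_le_mul_of_nonneg_right ?_ (hu0 N)
    calc (4 : ℝ) ^ (1 / r) ≤ 4 ^ (1 : ℝ) := Real.rpow_le_rpow_of_exponent_le (by norm_num)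
          ((div_le_one hr0).2 hr1.le)
      _ = 4 := Real.rpow_one 4
  have h10 : (n : ℝ) ^ (p / (d : ℝ)) / Real.log n ^ (1 / r) ≤
      2 * 4 * (u N * 2 ^ (-(t * N))) * n := by
    rw [e, div_eq_mul_inv]
    calc (n : ℝ) ^ (-t) * n * (Real.log n ^ (1 / r))⁻¹
        ≤ (2 * 2 ^ (-(t * N))) * n * (4 * u N) := by
          refine mul_le_mul (mul_le_mul_of_nonneg_right h5 hn0.le) h6 ?_ (by positivity)
          exact inv_nonneg.2 (Real.rpow_nonneg (Real.log_natCast_nonneg n) _)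
      _ = _ := by ring
  refine (ENNReal.ofReal_le_ofReal h10).trans (le_of_eq ?_)
  have hun := hu0 N
  rw [ENNReal.ofReal_mul (by positivity), ENNReal.ofReal_natCast,
    ENNReal.ofReal_mul (by positivity), ENNReal.ofReal_mul hun]
  simp only [hβ, pow2_eq_ofReal]
  congr 2
  rw [ENNReal.ofReal_mul (by norm_num)]
  simp

end Main

end EmpiricalWasserstein

theorem corollary4p1 {Ω : Type*} [MeasurableSpace Ω] (P : Measure Ω) [IsProbabilityMeasure P]
    (d : ℕ) (hd : 1 ≤ d)
    (μ : Measure (EuclideanSpace ℝ (Fin d))) [IsProbabilityMeasure μ]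
    (X : ℕ → Ω → EuclideanSpace ℝ (Fin d))
    (hX_meas : ∀ k, Measurable (X k))
    (hX_indep : iIndepFun X P)
    (hX_law : ∀ k, P.map (X k) = μ)
    (p r : ℝ) (hp : 1 ≤ p) (hr1 : 1 < r) (hr2 : r < 2)
    (hmoment : EmpiricalWasserstein.strongMoment (r * p) μ < ∞) :
    ((d : ℝ) * (r - 1) / r < p →
      ∀ᵐ ω ∂P, Tendsto
        (fun n : ℕ => ENNReal.ofReal ((n : ℝ) ^ ((r - 1) / r)) *
          EmpiricalWasserstein.wassersteinPow p
            (EmpiricalWasserstein.empiricalMeasure (fun k => X k ω) n) μ)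
        atTop (𝓝 0)) ∧
    (p < (d : ℝ) * (r - 1) / r →
      ∀ᵐ ω ∂P, Tendsto
        (fun n : ℕ => ENNReal.ofReal ((n : ℝ) ^ (p / (d : ℝ)) / Real.log (n : ℝ) ^ (1 / r)) *
          EmpiricalWasserstein.wassersteinPow p
            (EmpiricalWasserstein.empiricalMeasure (fun k => X k ω) n) μ)
        atTop (𝓝 0)) := by
  have hM := EmpiricalWasserstein.lintegral_pow2_shell_ne_top (by positivity) μ hmoment
  exact ⟨fun h => EmpiricalWasserstein.ae_tendsto_of_lt hX_meas hX_indep hX_law (by linarith)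
      hr1 hr2 h hM,
    fun h => EmpiricalWasserstein.ae_tendsto_of_gt hX_meas hX_indep hX_law (by omega)
      (by linarith) hr1 hr2 h hM⟩
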